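/- All graphs are simple and locally finite (possibly infinite or disconnected). For a graph $G$ with graph distance $d(\cdot,\cdot)$, a vertex $x$ of degree $d_x\ge 1$ and $\alpha\in[0,1]$, let $\mu_x^\alpha$ be the probability measure with $\mu_x^\alpha(x)=\alpha$, $\mu_x^\alpha(y)=\frac{1-\alpha}{d_x}$ for every neighbour $y$ of $x$, and $\mu_x^\alpha(y)=0$ otherwise. Let $W(\mu,\nu)=\inf_\pi\sum_{x,y}d(x,y)\,\pi(x,y)$ be the Wasserstein distance, the infimum being over all $\pi:V\times V\to[0,1]$ with marginals $\mu$ and $\nu$. For adjacent vertices $x,y$ put $$\kappa_\alpha(x,y)=1-\frac{W(\mu_x^\alpha,\mu_y^\alpha)}{d(x,y)},\qquad \kappa_{\mathrm{LLY}}(x,y)=\lim_{\alpha\to1^-}\frac{\kappa_\alpha(x,y)}{1-\alpha}.$$ The strong product $G\boxtimes H$ has vertex set $V(G)\times V(H)$, and two distinct vertices $(x_1,y_1)$, $(x_2,y_2)$ are adjacent if and only if $x_2\in N_G[x_1]$ and $y_2\in N_H[y_1]$, where $N_G[x]=\{x\}\cup N_G(x)$ denotes the closed neighbourhood. **Corollary.**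 Let $G$ and $H$ be regular graphs with vertex degrees $d_G$ and $d_H$, respectively. Let $x_1,x_2\in V(G)$ satisfy $N_G[x_1]=N_G[x_2]$ (the case $x_1=x_2$ is allowed), and let $y_1,y_2$ be adjacent vertices of $H$. Then $G\boxtimes H$ is regular of degree $d=d_G+d_H+d_Gd_H$, the limit defining $\kappa_{\mathrm{LLY}}(y_1,y_2)$ exists, and the following hold, where $\kappa_\alpha((x_1,y_1),(x_2,y_2))$ is taken in $G\boxtimes H$ and $\kappa_{\mathrm{LLY}}(y_1,y_2)$, $\kappa_0(y_1,y_2)$ are taken in $H$. If $\alpha\in\left[0,\frac1{d+1}\right]$, then $$\kappa_\alpha((x_1,y_1),(x_2,y_2))=d_H\bigl(\kappa_{\mathrm{LLY}}(y_1,y_2)-\kappa_0(y_1,y_2)\bigr)\alpha+\frac{d_H}{d}\bigl(d_G\,\kappa_{\mathrm{LLY}}(y_1,y_2)+\kappa_0(y_1,y_2)\bigr)(1-\alpha).$$ If $\alpha\in\left[\frac1{d+1},1\right]$, then $$\kappa_\alpha((x_1,y_1),(x_2,y_2))=\frac{d_H(d_G+1)}{d}\,\kappa_{\mathrm{LLY}}(y_1,y_2)\,(1-\alpha).$$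 -/

import Mathlib

open Filter Topology

namespace OllivierRicci

/-- The closed neighbourhood `N[x]`, that is `N(x)` together with `x` itself. -/
def closedNeighborSet {V : Type*} (G : SimpleGraph V) (x : V) : Set V :=
  insert x (G.neighborSet x)

/-- The strong product of two graphs: distinct vertices `(x₁, y₁)` and `(x₂, y₂)` are adjacent
iff `x₂ ∈ N[x₁]` and `y₂ ∈ N[y₁]`. -/
def strongProduct {V W : Type*} (G : SimpleGraph V) (H : SimpleGraph W) :
    SimpleGraph (V × W) where
  Adj p q := p ≠ q ∧ q.1 ∈ closedNeighborSet G p.1 ∧ q.2 ∈ closedNeighborSet H p.2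
  symm := ⟨by
    rintro p q ⟨hne, h₁, h₂⟩
    refine ⟨hne.symm, ?_, ?_⟩
    · rcases h₁ with h | h
      · exact Or.inl h.symm
      · exact Or.inr (G.adj_symm h)
    · rcases h₂ with h | h
      · exact Or.inl h.symm
      · exact Or.inr (H.adj_symm h)⟩
  loopless := ⟨fun _ h => h.1 rfl⟩

/-- The strong product of locally finite graphs is locally finite. -/
noncomputable instance strongProductLocallyFinite {V W : Type*} (G : SimpleGraph V)
    (H : SimpleGraph W) [G.LocallyFinite] [H.LocallyFinite] :
    (strongProduct G H).LocallyFinite := fun p =>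
  Set.Finite.fintype <|
    (((Set.toFinite (G.neighborSet p.1)).insert p.1).prod
      ((Set.toFinite (H.neighborSet p.2)).insert p.2)).subset fun _ hq => ⟨hq.2.1, hq.2.2⟩

open Classical in
/-- The measure `μ_x^α` of the random walk at `x` with idleness `α`. -/
noncomputable def walkMeasure {V : Type*} (G : SimpleGraph V) [G.LocallyFinite]
    (α : ℝ) (x : V) : V → ℝ := fun y =>
  if y = x then α else if G.Adj x y then (1 - α) / (G.degree x : ℝ) else 0

/-- The transport plans between `μ₁` and `μ₂`: maps `π : V × V → [0, 1]` whose marginals are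
`μ₁` and `μ₂`. -/
def transportPlans {V : Type*} (μ₁ μ₂ : V → ℝ) : Set (V × V → ℝ) :=
  {π | (∀ p, π p ∈ Set.Icc (0 : ℝ) 1) ∧
    (∀ x, HasSum (fun y => π (x, y)) (μ₁ x)) ∧ (∀ y, HasSum (fun x => π (x, y)) (μ₂ y))}

/-- The Wasserstein distance `W(μ₁, μ₂)`: the infimum of the costs `∑ d(x, y) π(x, y)` over the
plans `π` of finite cost. Vertices in different components are at infinite distance
(while `SimpleGraph.dist` is `0` there), so a plan moving mass between components is not of
finite cost. -/
noncomputable def wasserstein {V : Type*} (G : SimpleGraph V) (μ₁ μ₂ : V → ℝ) : ℝ :=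
  sInf {c : ℝ | ∃ π ∈ transportPlans μ₁ μ₂,
    (∀ p : V × V, π p ≠ 0 → G.Reachable p.1 p.2) ∧
    HasSum (fun p : V × V => (G.dist p.1 p.2 : ℝ) * π p) c}

/-- The `α`-Ricci curvature `κ_α(x, y) = 1 - W(μ_x^α, μ_y^α) / d(x, y)`. -/
noncomputable def ricciCurvature {V : Type*} (G : SimpleGraph V) [G.LocallyFinite]
    (α : ℝ) (x y : V) : ℝ :=
  1 - wasserstein G (walkMeasure G α x) (walkMeasure G α y) / (G.dist x y : ℝ)

/-- The Lin-Lu-Yau curvature `κ_LLY(x, y) = lim_{α → 1} κ_α(x, y) / (1 - α)`, where `α` ranges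
over `[0, 1)`. -/
noncomputable def llyCurvature {V : Type*} (G : SimpleGraph V) [G.LocallyFinite]
    (x y : V) : ℝ :=
  limUnder (𝓝[<] (1 : ℝ)) fun α => ricciCurvature G α x y / (1 - α)

end OllivierRicci

open OllivierRicci

/-! For α < 1, scaling the walk measure at a vertex of degree D by D/(1-α) gives `starMeasure G x
a`: unit masses on the neighbours and mass a = αD/(1-α) on x itself. Here a = 1, the uniform measure
on the closed ball, corresponds to α = 1/(D+1). For adjacent vertices of equal degree let T(a) be
the cost of transporting one star to the other. Then T is affine on [0,1]
(`transportCost_starMeasure_of_le_one`) and has slope 1 on [1,∞)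
(`transportCost_starMeasure_of_one_le`). Hence T(0) and T(1) determine every curvature; in
particular κ_0 = 1 - T(0)/D and κ_LLY = (D+1-T(1))/D.

The upper bounds for T come from adding and averaging plans. The lower bounds come from Birkhoff's
theorem: a plan, topped up at one entry to a doubly stochastic matrix, is an average of bijections,
and bijections can be compared by hand, cancelling common masses and rerouting.

It remains to compute T for the strong product: T(1) = (d_G+1) T_H(1) and T(0) = T_H(0) + d_G
T_H(1). Projection to H gives the lower bounds, since the image of a star is a multiple of a star in
H whose idleness lies in [0,1]. The upper bounds transport inside the fibres {k} × H. The delicate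
case is T(0) with x₁ ≠ x₂, where the two missing atoms lie in different fibres;
`transportable_fiber_pair` moves one unit between these fibres at no additional cost. -/

namespace OllivierRicci

/-! ### Finitely supported transport plans and their behaviour under graph maps. -/

variable {V W : Type*}

/-- The cost of a finitely supported transport plan. -/
noncomputable def planCost (G : SimpleGraph V) : (V × V →₀ ℝ) →ₗ[ℝ] ℝ :=
  Finsupp.linearCombination ℝ fun p : V × V => (G.dist p.1 p.2 : ℝ)

/-- The finitely supported mass distribution `μ` can be transported to `ν` at cost at most `c`. -/
def Transportable (G : SimpleGraph V) (μ ν : V →₀ ℝ) (c : ℝ) : Prop :=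
  ∃ π : V × V →₀ ℝ, (∀ p, 0 ≤ π p) ∧ π.mapDomain Prod.fst = μ ∧ π.mapDomain Prod.snd = ν ∧
    (∀ p, π p ≠ 0 → G.Reachable p.1 p.2) ∧ planCost G π ≤ c

/-- The Wasserstein distance of finitely supported mass distributions. -/
noncomputable def transportCost (G : SimpleGraph V) (μ ν : V →₀ ℝ) : ℝ :=
  sInf {c | Transportable G μ ν c}

theorem planCost_single (G : SimpleGraph V) (p : V × V) (w : ℝ) :
    planCost G (Finsupp.single p w) = w * G.dist p.1 p.2 := by
  simp [planCost]

theorem planCost_eq_sum (G : SimpleGraph V) (π : V × V →₀ ℝ) :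
    planCost G π = ∑ p ∈ π.support, π p * G.dist p.1 p.2 := by
  simp [planCost, Finsupp.linearCombination_apply, Finsupp.sum]

theorem planCost_nonneg (G : SimpleGraph V) {π : V × V →₀ ℝ} (h : ∀ p, 0 ≤ π p) :
    0 ≤ planCost G π := by
  rw [planCost_eq_sum]
  exact Finset.sum_nonneg fun p _ => mul_nonneg (h p) (Nat.cast_nonneg _)

namespace Transportable

variable {G : SimpleGraph V} {μ ν μ' ν' : V →₀ ℝ} {c c' : ℝ}

theorem nonneg (h : Transportable G μ ν c) : 0 ≤ c := by
  obtain ⟨π, h0, -, -, -, hc⟩ := h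
  exact (planCost_nonneg G h0).trans hc

theorem mono (h : Transportable G μ ν c) (hc : c ≤ c') : Transportable G μ ν c' := by
  obtain ⟨π, h0, h1, h2, h3, h4⟩ := h
  exact ⟨π, h0, h1, h2, h3, h4.trans hc⟩

theorem zero : Transportable G 0 0 0 :=
  ⟨0, by simp, by simp, by simp, by simp, by simp⟩

theorem add (h : Transportable G μ ν c) (h' : Transportable G μ' ν' c') :
    Transportable G (μ + μ') (ν + ν') (c + c') := by
  obtain ⟨π, h0, h1, h2, h3, h4⟩ := h
  obtain ⟨π', h0', h1', h2', h3', h4'⟩ := h'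
  refine ⟨π + π', fun p => add_nonneg (h0 p) (h0' p), ?_, ?_, fun p hp => ?_, ?_⟩
  · rw [Finsupp.mapDomain_add, h1, h1']
  · rw [Finsupp.mapDomain_add, h2, h2']
  · by_cases hz : π p = 0
    · exact h3' p fun hz' => hp (by simp [hz, hz'])
    · exact h3 p hz
  · rw [map_add]; exact add_le_add h4 h4'

theorem smul (h : Transportable G μ ν c) {r : ℝ} (hr : 0 ≤ r) :
    Transportable G (r • μ) (r • ν) (r * c) := by
  obtain ⟨π, h0, h1, h2, h3, h4⟩ := h
  refine ⟨r • π, fun p => mul_nonneg hr (h0 p), ?_, ?_, fun p hp => h3 p fun hz => hp ?_, ?_⟩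
  · rw [Finsupp.mapDomain_smul, h1]
  · rw [Finsupp.mapDomain_smul, h2]
  · simp [hz]
  · rw [map_smul]; exact mul_le_mul_of_nonneg_left h4 hr

theorem sum {ι : Type*} (s : Finset ι) {μ ν : ι → V →₀ ℝ} {c : ι → ℝ}
    (h : ∀ i ∈ s, Transportable G (μ i) (ν i) (c i)) :
    Transportable G (∑ i ∈ s, μ i) (∑ i ∈ s, ν i) (∑ i ∈ s, c i) := by
  classical
  induction s using Finset.induction_on with
  | empty => simpa using zero
  | insert i s hi ih =>
    rw [Finset.sum_insert hi, Finset.sum_insert hi, Finset.sum_insert hi]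
    exact (h i (by simp)).add (ih fun j hj => h j (by simp [hj]))

theorem single {x y : V} (h : G.Reachable x y) {w : ℝ} (hw : 0 ≤ w) :
    Transportable G (Finsupp.single x w) (Finsupp.single y w) (w * G.dist x y) := by
  classical
  refine ⟨Finsupp.single (x, y) w, fun p => ?_, by simp, by simp, fun p hp => ?_, ?_⟩
  · rw [Finsupp.single_apply]; split_ifs <;> simp [hw]
  · rw [Finsupp.single_apply] at hp
    split_ifs at hp with h'
    · subst h'; exact h
    · exact absurd rfl hp
  · rw [planCost_single]

theorem sum_single {ι : Type*} (s : Finset ι) {f g : ι → V}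
    (h : ∀ i ∈ s, G.Reachable (f i) (g i)) :
    Transportable G (∑ i ∈ s, Finsupp.single (f i) 1) (∑ i ∈ s, Finsupp.single (g i) 1)
      (∑ i ∈ s, (G.dist (f i) (g i) : ℝ)) := by
  simpa using sum s fun i hi => single (h i hi) zero_le_one

end Transportable

/-- A map that sends adjacent vertices to adjacent or equal ones does not increase distances. -/
theorem exists_walk_length_le {G : SimpleGraph V} {G' : SimpleGraph W} {f : V → W}
    (hf : ∀ u v, G.Adj u v → f u = f v ∨ G'.Adj (f u) (f v)) {u v : V} (w : G.Walk u v) :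
    ∃ w' : G'.Walk (f u) (f v), w'.length ≤ w.length := by
  induction w with
  | nil => exact ⟨.nil, le_rfl⟩
  | cons h p ih =>
    obtain ⟨w', hw'⟩ := ih
    rcases hf _ _ h with h' | h'
    · exact ⟨w'.copy h'.symm rfl, by simp; omega⟩
    · exact ⟨.cons h' w', by simpa using hw'⟩

theorem reachable_map {G : SimpleGraph V} {G' : SimpleGraph W} {f : V → W}
    (hf : ∀ u v, G.Adj u v → f u = f v ∨ G'.Adj (f u) (f v)) {u v : V} (h : G.Reachable u v) :
    G'.Reachable (f u) (f v) := by
  obtain ⟨w⟩ := h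
  exact ⟨(exists_walk_length_le hf w).choose⟩

theorem dist_map_le {G : SimpleGraph V} {G' : SimpleGraph W} {f : V → W}
    (hf : ∀ u v, G.Adj u v → f u = f v ∨ G'.Adj (f u) (f v)) {u v : V} (h : G.Reachable u v) :
    G'.dist (f u) (f v) ≤ G.dist u v := by
  obtain ⟨w, hw⟩ := h.exists_walk_length_eq_dist
  obtain ⟨w', hw'⟩ := exists_walk_length_le hf w
  exact (SimpleGraph.dist_le w').trans (hw'.trans hw.le)

/-- Push the plan forward atom by atom; no atom travels farther than before. This serves both for
the projection of the strong product to H and for the inclusions of its fibres. -/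
theorem Transportable.map {G : SimpleGraph V} {G' : SimpleGraph W} {μ ν : V →₀ ℝ} {c : ℝ}
    (h : Transportable G μ ν c) {f : V → W}
    (hf : ∀ u v, G.Adj u v → f u = f v ∨ G'.Adj (f u) (f v)) :
    Transportable G' (μ.mapDomain f) (ν.mapDomain f) c := by
  obtain ⟨π, h0, h1, h2, h3, h4⟩ := h
  have key : Transportable G' (∑ p ∈ π.support, Finsupp.single (f p.1) (π p))
      (∑ p ∈ π.support, Finsupp.single (f p.2) (π p))
      (∑ p ∈ π.support, π p * G'.dist (f p.1) (f p.2)) :=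
    Transportable.sum _ fun p hp =>
      Transportable.single (reachable_map hf (h3 p (Finsupp.mem_support_iff.1 hp))) (h0 p)
  have e1 : μ.mapDomain f = ∑ p ∈ π.support, Finsupp.single (f p.1) (π p) := by
    rw [← h1, ← Finsupp.mapDomain_comp]; rfl
  have e2 : ν.mapDomain f = ∑ p ∈ π.support, Finsupp.single (f p.2) (π p) := by
    rw [← h2, ← Finsupp.mapDomain_comp]; rfl
  rw [e1, e2]
  refine key.mono (le_trans ?_ h4)
  rw [planCost_eq_sum]
  refine Finset.sum_le_sum fun p hp => mul_le_mul_of_nonneg_left ?_ (h0 p)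
  exact_mod_cast dist_map_le hf (h3 p (Finsupp.mem_support_iff.1 hp))

/-! ### The optimal cost and its agreement with the Wasserstein distance. -/

section transportCost

variable {G : SimpleGraph V} {μ ν μ' ν' : V →₀ ℝ} {c : ℝ}

theorem transportCost_le (h : Transportable G μ ν c) : transportCost G μ ν ≤ c :=
  csInf_le ⟨0, fun _ h => h.nonneg⟩ h

theorem le_transportCost (hne : ∃ c, Transportable G μ ν c)
    (h : ∀ c', Transportable G μ ν c' → c ≤ c') : c ≤ transportCost G μ ν :=
  le_csInf hne h

theorem transportCost_nonneg : 0 ≤ transportCost G μ ν :=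
  Real.sInf_nonneg fun _ h => Transportable.nonneg h

open scoped Pointwise in
theorem transportCost_smul {r : ℝ} (hr : 0 ≤ r) :
    transportCost G (r • μ) (r • ν) = r * transportCost G μ ν := by
  rcases hr.eq_or_lt with rfl | hr
  · simp only [zero_smul, zero_mul]
    exact (transportCost_le Transportable.zero).antisymm transportCost_nonneg
  have : {c | Transportable G (r • μ) (r • ν) c} = r • {c | Transportable G μ ν c} := by
    ext c
    rw [Set.mem_smul_set]
    constructor
    · intro h
      refine ⟨r⁻¹ * c, ?_, ?_⟩
      · have := h.smul (inv_nonneg.2 hr.le)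
        rwa [smul_smul, smul_smul, inv_mul_cancel₀ hr.ne', one_smul, one_smul] at this
      · simp [hr.ne']
    · rintro ⟨c', h, rfl⟩
      exact Transportable.smul h hr.le
  rw [transportCost, this, Real.sInf_smul_of_nonneg hr.le]
  rfl

theorem transportCost_add_le (h : ∃ c, Transportable G μ ν c)
    (h' : ∃ c, Transportable G μ' ν' c) :
    transportCost G (μ + μ') (ν + ν') ≤ transportCost G μ ν + transportCost G μ' ν' := by
  rw [← sub_le_iff_le_add]
  refine le_transportCost h fun c hc => ?_
  rw [sub_le_comm]
  refine le_transportCost h' fun c' hc' => ?_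
  rw [sub_le_iff_le_add']
  exact transportCost_le (hc.add hc')

theorem mapDomain_fst_apply (π : V × V →₀ ℝ) {t : Finset V} (ht : ∀ p, π p ≠ 0 → p.2 ∈ t) (x : V) :
    π.mapDomain Prod.fst x = ∑ y ∈ t, π (x, y) := by
  classical
  rw [Finsupp.mapDomain, Finsupp.sum, Finsupp.finsetSum_apply]
  simp only [Finsupp.single_apply]
  rw [← Finset.sum_filter]
  symm
  refine Finset.sum_bij_ne_zero (fun y _ _ => (x, y)) ?_ ?_ ?_ ?_
  · intro y _ h; simpa using h
  · intro y _ _ y' _ _ h; simpa using h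
  · rintro ⟨a, b⟩ h h'
    simp only [Finset.mem_filter] at h
    obtain ⟨-, rfl⟩ := h
    exact ⟨b, ht _ h', h', rfl⟩
  · intros; rfl

theorem mapDomain_snd_apply (π : V × V →₀ ℝ) {t : Finset V} (ht : ∀ p, π p ≠ 0 → p.1 ∈ t) (y : V) :
    π.mapDomain Prod.snd y = ∑ x ∈ t, π (x, y) := by
  classical
  rw [Finsupp.mapDomain, Finsupp.sum, Finsupp.finsetSum_apply]
  simp only [Finsupp.single_apply]
  rw [← Finset.sum_filter]
  symm
  refine Finset.sum_bij_ne_zero (fun x _ _ => (x, y)) ?_ ?_ ?_ ?_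
  · intro x _ h; simpa using h
  · intro y _ _ y' _ _ h; simpa using h
  · rintro ⟨a, b⟩ h h'
    simp only [Finset.mem_filter] at h
    obtain ⟨-, rfl⟩ := h
    exact ⟨a, ht _ h', h', rfl⟩
  · intros; rfl

theorem eq_zero_of_mapDomain_fst_eq_zero {π : V × V →₀ ℝ} (h0 : ∀ p, 0 ≤ π p) {p : V × V}
    (h : π.mapDomain Prod.fst p.1 = 0) : π p = 0 := by
  classical
  by_contra hp
  rw [mapDomain_fst_apply π (t := π.support.image Prod.snd) (fun p hp =>
    Finset.mem_image_of_mem _ (Finsupp.mem_support_iff.2 hp)),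
    Finset.sum_eq_zero_iff_of_nonneg fun _ _ => h0 _] at h
  exact hp (h p.2 (Finset.mem_image_of_mem _ (Finsupp.mem_support_iff.2 hp)))

theorem eq_zero_of_mapDomain_snd_eq_zero {π : V × V →₀ ℝ} (h0 : ∀ p, 0 ≤ π p) {p : V × V}
    (h : π.mapDomain Prod.snd p.2 = 0) : π p = 0 := by
  classical
  by_contra hp
  rw [mapDomain_snd_apply π (t := π.support.image Prod.fst) (fun p hp =>
    Finset.mem_image_of_mem _ (Finsupp.mem_support_iff.2 hp)),
    Finset.sum_eq_zero_iff_of_nonneg fun _ _ => h0 _] at h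
  exact hp (h p.1 (Finset.mem_image_of_mem _ (Finsupp.mem_support_iff.2 hp)))

/-- A nonnegative plan vanishes wherever a marginal does, so finitely supported marginals force a
finitely supported plan. Conversely an entry is at most its first marginal, which is why `hμ` yields
the bound π ≤ 1. -/
theorem wasserstein_eq_transportCost (G : SimpleGraph V) (μ ν : V →₀ ℝ) (hμ : ∀ x, μ x ≤ 1) :
    wasserstein G μ ν = transportCost G μ ν := by
  classical
  set S : Set ℝ := {c : ℝ | ∃ π ∈ transportPlans μ ν,
    (∀ p : V × V, π p ≠ 0 → G.Reachable p.1 p.2) ∧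
    HasSum (fun p : V × V => (G.dist p.1 p.2 : ℝ) * π p) c} with hS
  have hle : ∀ c, Transportable G μ ν c → ∃ c' ∈ S, c' ≤ c := by
    rintro c ⟨π, h0, h1, h2, h3, h4⟩
    have hfst : ∀ p, π p ≠ 0 → p.1 ∈ π.support.image Prod.fst := fun p hp =>
      Finset.mem_image_of_mem _ (Finsupp.mem_support_iff.2 hp)
    have hsnd : ∀ p, π p ≠ 0 → p.2 ∈ π.support.image Prod.snd := fun p hp =>
      Finset.mem_image_of_mem _ (Finsupp.mem_support_iff.2 hp)
    refine ⟨planCost G π, ⟨π, ⟨fun p => ⟨h0 p, ?_⟩, fun x => ?_, fun y => ?_⟩, h3, ?_⟩, h4⟩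
    · by_cases hp : π p = 0
      · simp [hp]
      refine le_trans ?_ (hμ p.1)
      rw [← h1, mapDomain_fst_apply π hsnd]
      exact Finset.single_le_sum (f := fun y => π (p.1, y)) (fun y _ => h0 _) (hsnd p hp)
    · rw [← h1, mapDomain_fst_apply π hsnd]
      exact hasSum_sum_of_ne_finset_zero fun y hy => by_contra fun hne => hy (hsnd (x, y) hne)
    · rw [← h2, mapDomain_snd_apply π hfst]
      exact hasSum_sum_of_ne_finset_zero fun x hx => by_contra fun hne => hx (hfst (x, y) hne)
    · rw [planCost_eq_sum]
      simp only [mul_comm (π _)]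
      exact hasSum_sum_of_ne_finset_zero fun p hp => by
        rw [Finsupp.notMem_support_iff.1 hp, mul_zero]
  have hge : ∀ c ∈ S, Transportable G μ ν c := by
    rintro c ⟨π, ⟨h01, hr, hc⟩, h3, h4⟩
    have hz1 : ∀ p, π p ≠ 0 → p.1 ∈ μ.support := fun p hp => by
      rw [Finsupp.mem_support_iff]
      intro h
      have := hr p.1
      rw [h, hasSum_zero_iff_of_nonneg fun y => (h01 _).1] at this
      exact hp (congrFun this p.2)
    have hz2 : ∀ p, π p ≠ 0 → p.2 ∈ ν.support := fun p hp => by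
      rw [Finsupp.mem_support_iff]
      intro h
      have := hc p.2
      rw [h, hasSum_zero_iff_of_nonneg fun y => (h01 _).1] at this
      exact hp (congrFun this p.1)
    let π' : V × V →₀ ℝ := Finsupp.onFinset (μ.support ×ˢ ν.support) π fun p hp =>
      Finset.mem_product.2 ⟨hz1 p hp, hz2 p hp⟩
    refine ⟨π', fun p => (h01 p).1, ?_, ?_, h3, ?_⟩
    · ext x
      rw [mapDomain_fst_apply π' hz2]
      exact (hasSum_sum_of_ne_finset_zero fun y hy =>
        by_contra fun hne => hy (hz2 (x, y) hne)).unique (hr x)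
    · ext y
      rw [mapDomain_snd_apply π' hz1]
      exact (hasSum_sum_of_ne_finset_zero fun x hx =>
        by_contra fun hne => hx (hz1 (x, y) hne)).unique (hc y)
    · refine le_of_eq (HasSum.unique ?_ h4)
      rw [planCost_eq_sum]
      simp only [mul_comm (π' _)]
      refine hasSum_sum_of_ne_finset_zero (f := fun p : V × V => (G.dist p.1 p.2 : ℝ) * π p)
        fun p hp => ?_
      have : π p = 0 := Finsupp.notMem_support_iff.1 hp
      rw [this, mul_zero]
  have hbdd : BddBelow S := ⟨0, fun c hc => (hge c hc).nonneg⟩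
  change sInf S = sInf {c | Transportable G μ ν c}
  rcases S.eq_empty_or_nonempty with he | hne
  · congr 1
    rw [he]
    symm
    rw [Set.eq_empty_iff_forall_notMem]
    intro c hc
    obtain ⟨c', hc', -⟩ := hle c hc
    simp [he] at hc'
  · apply le_antisymm
    · refine le_csInf (hne.mono hge) fun c hc => ?_
      obtain ⟨c', hc', hcc⟩ := hle c hc
      exact (csInf_le hbdd hc').trans hcc
    · exact csInf_le_csInf ⟨0, fun c hc => Transportable.nonneg hc⟩ hne hge

end transportCost

end OllivierRicci

/-! ### Birkhoff's theorem and matchings of labelled masses. -/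

namespace OllivierRicci

variable {V : Type*} {R C : Type*} [Fintype R] [Fintype C]

/-- A bound for linear functionals on doubly stochastic matrices with a heavy entry, from bounds
on bijections. -/
theorem le_sum_mul_of_forall_equiv [DecidableEq R] (e : R ≃ C) {M K : R → C → ℝ}
    (h0 : ∀ r c, 0 ≤ M r c)
    (hr : ∀ r, ∑ c, M r c = 1) (hc : ∀ c, ∑ r, M r c = 1) {r₀ : R} {c₀ : C} {t L₀ L₁ : ℝ}
    (ht : 1 - t ≤ M r₀ c₀) (hL : L₁ ≤ L₀) (h1 : ∀ σ : R ≃ C, L₁ ≤ ∑ r, K r (σ r))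
    (h2 : ∀ σ : R ≃ C, σ r₀ = c₀ → L₀ ≤ ∑ r, K r (σ r)) :
    (1 - t) * L₀ + t * L₁ ≤ ∑ r, ∑ c, M r c * K r c := by
  classical
  let A : Matrix R R ℝ := Matrix.of fun r s => M r (e s)
  have hA : A ∈ doublyStochastic ℝ R := by
    rw [mem_doublyStochastic_iff_sum]
    refine ⟨fun r s => h0 _ _, fun r => ?_, fun s => hc _⟩
    rw [← hr r]
    exact e.sum_comp fun c => M r c
  -- Birkhoff–von Neumann, after identifying columns with rows through `e`.
  obtain ⟨w, hw0, hw1, hw⟩ := exists_eq_sum_perm_of_mem_doublyStochastic hA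
  have hM : ∀ r s, M r (e s) = ∑ σ : Equiv.Perm R, if σ r = s then w σ else 0 := by
    intro r s
    rw [← show A r s = M r (e s) from rfl, ← hw, Matrix.sum_apply]
    refine Finset.sum_congr rfl fun σ _ => ?_
    simp [Equiv.Perm.permMatrix, PEquiv.toMatrix_apply, Equiv.toPEquiv, eq_comm]
  have hcost : ∑ r, ∑ c, M r c * K r c =
      ∑ σ : Equiv.Perm R, w σ * ∑ r, K r ((σ.trans e) r) := by
    have : ∀ r, ∑ c, M r c * K r c = ∑ σ : Equiv.Perm R, w σ * K r (e (σ r)) := by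
      intro r
      rw [← e.sum_comp]
      simp only [hM, Finset.sum_mul]
      rw [Finset.sum_comm]
      refine Finset.sum_congr rfl fun σ _ => ?_
      simp [ite_mul]
    simp only [this, Finset.mul_sum]
    rw [Finset.sum_comm]
    rfl
  have hm : M r₀ c₀ = ∑ σ : Equiv.Perm R, if σ r₀ = e.symm c₀ then w σ else 0 := by
    rw [← hM, e.apply_symm_apply]
  rw [hcost]
  -- `M r₀ c₀` is the total weight of the bijections matching `r₀` with `c₀`; these cost at least
  -- `L₀`, the others at least `L₁`.
  calc (1 - t) * L₀ + t * L₁ ≤ M r₀ c₀ * (L₀ - L₁) + L₁ := by nlinarith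
    _ = ∑ σ : Equiv.Perm R, ((if σ r₀ = e.symm c₀ then w σ else 0) * (L₀ - L₁) + w σ * L₁) := by
      rw [Finset.sum_add_distrib, ← Finset.sum_mul, ← Finset.sum_mul, hw1, hm, one_mul]
    _ ≤ _ := by
      refine Finset.sum_le_sum fun σ _ => ?_
      split_ifs with h
      · have := mul_le_mul_of_nonneg_left (h2 (σ.trans e) (by simp [h])) (hw0 σ)
        linarith
      · have := mul_le_mul_of_nonneg_left (h1 (σ.trans e)) (hw0 σ)
        linarith

theorem sum_single_apply [DecidableEq V] (l : R → V) (w : R → ℝ) (x : V) :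
    (∑ r, Finsupp.single (l r) (w r)) x = ∑ r with l r = x, w r := by
  rw [Finsupp.finsetSum_apply, Finset.sum_filter]
  simp only [Finsupp.single_apply]

/-- Summing a function over labels, in proportion to their weights, is summing it over points. -/
theorem sum_mul_div_eq (l : R → V) (w : R → ℝ) {μ : V →₀ ℝ}
    (hμ : ∑ r, Finsupp.single (l r) (w r) = μ) (g : V → ℝ) {S : Finset V}
    (hS : ∀ r, l r ∈ S) (hg : ∀ x, μ x = 0 → g x = 0) :
    ∑ r, g (l r) * (w r / μ (l r)) = ∑ x ∈ S, g x := by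
  classical
  rw [← Finset.sum_fiberwise_of_maps_to (s := Finset.univ) (t := S) (g := l) fun r _ => hS r]
  refine Finset.sum_congr rfl fun x _ => ?_
  have : ∑ r with l r = x, g (l r) * (w r / μ (l r)) = g x / μ x * ∑ r with l r = x, w r := by
    rw [Finset.mul_sum]
    refine Finset.sum_congr rfl fun r hr => ?_
    rw [(Finset.mem_filter.1 hr).2]
    ring
  rw [this, ← sum_single_apply l w, hμ]
  by_cases h : μ x = 0
  · simp [hg x h]
  · field_simp

/-- A transport plan between labelled masses comes from a matrix indexed by the labels. -/
theorem Transportable.exists_matrix {G : SimpleGraph V} {lR : R → V} {lC : C → V} {wR : R → ℝ}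
    {wC : C → ℝ} (hR : ∀ r, 0 ≤ wR r) (hC : ∀ c, 0 ≤ wC c) {a : ℝ}
    (h : Transportable G (∑ r, Finsupp.single (lR r) (wR r)) (∑ c, Finsupp.single (lC c) (wC c)) a) :
    ∃ M : R → C → ℝ, (∀ r c, 0 ≤ M r c) ∧ (∀ r, ∑ c, M r c = wR r) ∧
      (∀ c, ∑ r, M r c = wC c) ∧ ∑ r, ∑ c, M r c * G.dist (lR r) (lC c) ≤ a := by
  classical
  set μ := ∑ r, Finsupp.single (lR r) (wR r) with hμ
  set ν := ∑ c, Finsupp.single (lC c) (wC c) with hν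
  obtain ⟨π, h0, h1, h2, h3, h4⟩ := h
  have hμ0 : ∀ x, 0 ≤ μ x := fun x => by
    rw [hμ, sum_single_apply]; exact Finset.sum_nonneg fun r _ => hR r
  have hν0 : ∀ x, 0 ≤ ν x := fun x => by
    rw [hν, sum_single_apply]; exact Finset.sum_nonneg fun r _ => hC r
  have hz1 : ∀ x y, μ x = 0 → π (x, y) = 0 := fun x y h =>
    eq_zero_of_mapDomain_fst_eq_zero h0 (by rwa [h1])
  have hz2 : ∀ x y, ν y = 0 → π (x, y) = 0 := fun x y h =>
    eq_zero_of_mapDomain_snd_eq_zero h0 (by rwa [h2])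
  have hsupp1 : ∀ p, π p ≠ 0 → p.1 ∈ Finset.univ.image lR := by
    intro p hp
    by_contra hn
    refine hp (hz1 _ _ ?_)
    rw [hμ, sum_single_apply]
    refine Finset.sum_eq_zero fun r hr => absurd ?_ hn
    rw [← (Finset.mem_filter.1 hr).2]
    exact Finset.mem_image_of_mem _ (Finset.mem_univ _)
  have hsupp2 : ∀ p, π p ≠ 0 → p.2 ∈ Finset.univ.image lC := by
    intro p hp
    by_contra hn
    refine hp (hz2 _ _ ?_)
    rw [hν, sum_single_apply]
    refine Finset.sum_eq_zero fun r hr => absurd ?_ hn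
    rw [← (Finset.mem_filter.1 hr).2]
    exact Finset.mem_image_of_mem _ (Finset.mem_univ _)
  have hSR : ∀ r, lR r ∈ Finset.univ.image lR := fun r =>
    Finset.mem_image_of_mem _ (Finset.mem_univ _)
  have hSC : ∀ c, lC c ∈ Finset.univ.image lC := fun r =>
    Finset.mem_image_of_mem _ (Finset.mem_univ _)
  -- Several labels may sit at one point, so π(x, y) is shared among the labels at x and y in
  -- proportion to their weights. Where the total mass is 0, all weights are 0 too and division by
  -- zero is harmless.
  refine ⟨fun r c => π (lR r, lC c) * (wR r / μ (lR r)) * (wC c / ν (lC c)), fun r c => ?_,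
    fun r => ?_, fun c => ?_, ?_⟩
  · exact mul_nonneg (mul_nonneg (h0 _) (div_nonneg (hR r) (hμ0 _))) (div_nonneg (hC c) (hν0 _))
  · rw [sum_mul_div_eq lC wC hν.symm (fun y => π (lR r, y) * (wR r / μ (lR r))) hSC
      fun y hy => by simp [hz2 _ _ hy], ← Finset.sum_mul, ← mapDomain_fst_apply π hsupp2, h1]
    by_cases hr : μ (lR r) = 0
    · have : wR r = 0 := by
        rw [hμ, sum_single_apply, Finset.sum_eq_zero_iff_of_nonneg fun r _ => hR r] at hr
        exact hr r (by simp)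
      simp [this]
    · field_simp
  · have e : ∀ r, π (lR r, lC c) * (wR r / μ (lR r)) * (wC c / ν (lC c)) =
        (π (lR r, lC c) * (wC c / ν (lC c))) * (wR r / μ (lR r)) := fun r => by ring
    simp only [e]
    rw [sum_mul_div_eq lR wR hμ.symm (fun x => π (x, lC c) * (wC c / ν (lC c))) hSR
      fun y hy => by simp [hz1 _ _ hy], ← Finset.sum_mul, ← mapDomain_snd_apply π hsupp1, h2]
    by_cases hr : ν (lC c) = 0
    · have : wC c = 0 := by
        rw [hν, sum_single_apply, Finset.sum_eq_zero_iff_of_nonneg fun r _ => hC r] at hr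
        exact hr c (by simp)
      simp [this]
    · field_simp
  · refine le_trans (le_of_eq ?_) h4
    have e : ∀ r, ∑ c, π (lR r, lC c) * (wR r / μ (lR r)) * (wC c / ν (lC c)) *
        G.dist (lR r) (lC c) = (∑ y ∈ Finset.univ.image lC, π (lR r, y) * G.dist (lR r) y) *
          (wR r / μ (lR r)) := fun r => by
      rw [Finset.sum_mul, ← sum_mul_div_eq lC wC hν.symm
        (fun y => π (lR r, y) * G.dist (lR r) y * (wR r / μ (lR r))) hSC
        fun y hy => by simp [hz2 _ _ hy]]
      exact Finset.sum_congr rfl fun c _ => by ring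
    simp only [e]
    rw [sum_mul_div_eq lR wR hμ.symm
      (fun x => ∑ y ∈ Finset.univ.image lC, π (x, y) * G.dist x y) hSR
      fun x hx => by simp [hz1 _ _ hx], ← Finset.sum_product', planCost_eq_sum]
    symm
    refine Finset.sum_subset (fun p hp => ?_) fun p _ hp => ?_
    · rw [Finsupp.mem_support_iff] at hp
      exact Finset.mem_product.2 ⟨hsupp1 p hp, hsupp2 p hp⟩
    · rw [Finsupp.notMem_support_iff.1 hp, zero_mul]

/-- A lower bound for transport costs between unit masses, one of which is lowered to `t`, from
lower bounds on the costs of bijections. -/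
theorem Transportable.le_of_forall_equiv [DecidableEq R] [DecidableEq C] {G : SimpleGraph V}
    (e : R ≃ C)
    {lR : R → V} {lC : C → V} {r₀ : R} {c₀ : C} {t L₀ L₁ a : ℝ} (ht0 : 0 ≤ t) (ht1 : t ≤ 1)
    (hL : L₁ ≤ L₀) (h1 : ∀ σ : R ≃ C, L₁ ≤ ∑ r, (G.dist (lR r) (lC (σ r)) : ℝ))
    (h2 : ∀ σ : R ≃ C, σ r₀ = c₀ → L₀ ≤ ∑ r, (G.dist (lR r) (lC (σ r)) : ℝ))
    (h : Transportable G (∑ r, Finsupp.single (lR r) (if r = r₀ then t else 1))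
      (∑ c, Finsupp.single (lC c) (if c = c₀ then t else 1)) a) :
    (1 - t) * L₀ + t * L₁ ≤ a + (1 - t) * G.dist (lR r₀) (lC c₀) := by
  obtain ⟨M, h0, hr, hc, hM⟩ := h.exists_matrix (fun r => by split_ifs <;> linarith)
    (fun c => by split_ifs <;> linarith)
  -- Adding the missing mass 1 - t at the entry (r₀, c₀) makes all row and column sums 1, and makes
  -- that entry at least 1 - t.
  have key := le_sum_mul_of_forall_equiv e
    (M := fun r c => M r c + if r = r₀ then (if c = c₀ then 1 - t else 0) else 0)
    (K := fun r c => (G.dist (lR r) (lC c) : ℝ)) (r₀ := r₀) (c₀ := c₀) (t := t)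
    (fun r c => add_nonneg (h0 r c) (by split_ifs <;> linarith))
    (fun r => by
      rw [Finset.sum_add_distrib, hr]
      by_cases h : r = r₀ <;> simp [h])
    (fun c => by
      rw [Finset.sum_add_distrib, hc]
      by_cases h : c = c₀ <;> simp [h])
    (by simpa using h0 r₀ c₀) hL h1 h2
  refine key.trans ?_
  simp only [add_mul, Finset.sum_add_distrib, ite_mul, zero_mul]
  refine add_le_add hM (le_of_eq ?_)
  simp [Finset.sum_ite_eq']

/-- Between unit masses, some bijection is at least as good as any given transport plan. -/
theorem Transportable.exists_equiv {G : SimpleGraph V} (e : R ≃ C) {lR : R → V} {lC : C → V} {a : ℝ}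
    (h : Transportable G (∑ r, Finsupp.single (lR r) 1) (∑ c, Finsupp.single (lC c) 1) a) :
    ∃ σ : R ≃ C, ∑ r, (G.dist (lR r) (lC (σ r)) : ℝ) ≤ a := by
  classical
  rcases isEmpty_or_nonempty R with hR | ⟨⟨r₀⟩⟩
  · exact ⟨e, by simpa using h.nonneg⟩
  have : Nonempty (R ≃ C) := ⟨e⟩
  obtain ⟨σ, -, hσ⟩ := Finset.exists_min_image Finset.univ
    (fun σ : R ≃ C => ∑ r, (G.dist (lR r) (lC (σ r)) : ℝ)) Finset.univ_nonempty
  refine ⟨σ, ?_⟩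
  -- With t = 1 no mass is lowered, and the minimal cost of a bijection serves as both bounds.
  have := Transportable.le_of_forall_equiv (r₀ := r₀) (c₀ := e r₀) (t := 1) e zero_le_one le_rfl
    le_rfl (fun τ => hσ τ (Finset.mem_univ _)) (fun τ _ => hσ τ (Finset.mem_univ _))
    (by simpa using h)
  linarith

/-- A bijection of labels is a transport plan. -/
theorem Transportable.of_equiv {G : SimpleGraph V} (σ : R ≃ C) {lR : R → V} {lC : C → V}
    (h : ∀ r c, G.Reachable (lR r) (lC c)) :
    Transportable G (∑ r, Finsupp.single (lR r) 1) (∑ c, Finsupp.single (lC c) 1)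
      (∑ r, (G.dist (lR r) (lC (σ r)) : ℝ)) := by
  have := Transportable.sum_single Finset.univ (f := lR) (g := fun r => lC (σ r))
    fun r _ => h r (σ r)
  rwa [σ.sum_comp fun c => Finsupp.single (lC c) (1 : ℝ)] at this

omit [Fintype C] in
/-- A unit mass that stays in place can be removed from a matching problem. -/
theorem exists_equiv_of_option_equiv {G : SimpleGraph V} {lR : Option R → V} {lC : Option C → V}
    (h : ∀ r c, G.Reachable (lR r) (lC c)) (hz : lR none = lC none) (σ : Option R ≃ Option C) :
    ∃ τ : R ≃ C, ∑ r, (G.dist (lR (some r)) (lC (some (τ r))) : ℝ) ≤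
      ∑ r, (G.dist (lR r) (lC (σ r)) : ℝ) := by
  classical
  refine ⟨Equiv.removeNone σ, ?_⟩
  rw [Fintype.sum_option]
  by_cases hn : σ none = none
  · rw [hn]
    refine le_add_of_nonneg_of_le (Nat.cast_nonneg _) (Finset.sum_le_sum fun r _ => ?_)
    rw [Equiv.removeNone_some σ]
    rcases hr : σ (some r) with _ | c
    · exact absurd (σ.injective (hr.trans hn.symm)) (by simp)
    · exact ⟨c, rfl⟩
  · obtain ⟨r₁, hr₁⟩ : ∃ r₁, σ (some r₁) = none := by
      rcases h' : σ.symm none with _ | r₁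
      · exact absurd (by rw [← h', σ.apply_symm_apply]) hn
      · exact ⟨r₁, by rw [← h', σ.apply_symm_apply]⟩
    rw [← Finset.add_sum_erase _ _ (Finset.mem_univ r₁),
      ← Finset.add_sum_erase (a := r₁) _ (fun r => (G.dist (lR (some r)) (lC (σ (some r))) : ℝ))
        (Finset.mem_univ r₁), ← add_assoc, Equiv.removeNone_none σ hr₁, hr₁]
    -- The unit arriving at the common point and the unit leaving it are replaced by one direct
    -- move; the triangle inequality compares the costs.
    refine add_le_add ?_ (Finset.sum_le_sum fun r hr => ?_)
    · have := (h (some r₁) none).dist_triangle_left (lC (σ none))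
      rw [hz]
      rw [add_comm]
      exact_mod_cast this
    · rw [Equiv.removeNone_some σ]
      rcases hr' : σ (some r) with _ | c
      · exact absurd (Option.some_injective _ (σ.injective (hr'.trans hr₁.symm)))
          (Finset.ne_of_mem_erase hr)
      · exact ⟨c, rfl⟩

omit [Fintype C] in
/-- Unit masses common to both sides can be removed from a matching problem. -/
theorem exists_equiv_of_sum_equiv {G : SimpleGraph V} {Z : Type*} [Finite Z]
    {lZ : Z → V} {lR : R → V} {lC : C → V} {x : V} (hZ : ∀ z, G.Reachable x (lZ z))
    (hR : ∀ r, G.Reachable x (lR r)) (hC : ∀ c, G.Reachable x (lC c)) (σ : Z ⊕ R ≃ Z ⊕ C) :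
    ∃ τ : R ≃ C, ∀ [Fintype Z], ∑ r, (G.dist (lR r) (lC (τ r)) : ℝ) ≤
      ∑ r, (G.dist (Sum.elim lZ lR r) (Sum.elim lZ lC (σ r)) : ℝ) := by
  classical
  -- The common masses are cancelled one at a time. The `Fintype` instance is quantified inside the
  -- conclusion because this induction runs over `Finite` types.
  induction Z using Finite.induction_empty_option with
  | of_equiv e ih =>
    obtain ⟨τ, hτ⟩ := ih (lZ := lZ ∘ e) (fun z => hZ _)
      (((e.sumCongr (Equiv.refl R)).trans σ).trans (e.symm.sumCongr (Equiv.refl C)))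
    refine ⟨τ, fun {_} => ?_⟩
    have := Fintype.ofEquiv _ e.symm
    refine hτ.trans (le_of_eq ?_)
    rw [← (e.sumCongr (Equiv.refl R)).sum_comp]
    refine Finset.sum_congr rfl fun r _ => ?_
    congr 2
    · rcases r with r | r <;> rfl
    · simp only [Equiv.trans_apply]
      rcases σ ((e.sumCongr (Equiv.refl R)) r) with c | c <;> simp
  | h_empty =>
    refine ⟨((Equiv.emptySum PEmpty R).symm.trans σ).trans (Equiv.emptySum PEmpty C),
      fun {_} => le_of_eq ?_⟩
    rw [← (Equiv.emptySum PEmpty R).symm.sum_comp]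
    refine Finset.sum_congr rfl fun r _ => ?_
    simp only [Equiv.trans_apply, Equiv.emptySum_symm_apply, Sum.elim_inr]
    rcases σ (Sum.inr r) with c | c
    · exact c.elim
    · rfl
  | @h_option Z _ ih =>
    let eR : Option (Z ⊕ R) ≃ Option Z ⊕ R :=
      (Equiv.optionEquivSumPUnit.{0} _).trans <| (Equiv.sumComm _ _).trans <|
        (Equiv.sumAssoc _ _ _).symm.trans <|
        ((Equiv.sumComm _ _).trans (Equiv.optionEquivSumPUnit.{0} Z).symm).sumCongr (Equiv.refl R)
    let eC : Option (Z ⊕ C) ≃ Option Z ⊕ C :=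
      (Equiv.optionEquivSumPUnit.{0} _).trans <| (Equiv.sumComm _ _).trans <|
        (Equiv.sumAssoc _ _ _).symm.trans <|
        ((Equiv.sumComm _ _).trans (Equiv.optionEquivSumPUnit.{0} Z).symm).sumCongr (Equiv.refl C)
    have hRr : ∀ r, G.Reachable x (Sum.elim lZ lR r) := by rintro (z | r) <;> simp [hZ, hR]
    have hCr : ∀ r, G.Reachable x (Sum.elim lZ lC r) := by rintro (z | r) <;> simp [hZ, hC]
    obtain ⟨σ', hσ'⟩ := exists_equiv_of_option_equiv (G := G)
      (lR := Sum.elim lZ lR ∘ eR) (lC := Sum.elim lZ lC ∘ eC)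
      (fun r c => (hRr _).symm.trans (hCr _)) rfl ((eR.trans σ).trans eC.symm)
    obtain ⟨τ, hτ⟩ := ih (lZ := fun z => lZ (some z)) (fun z => hZ _) σ'
    refine ⟨τ, fun {_} => hτ.trans ?_⟩
    have : ∑ r, (G.dist (Sum.elim lZ lR r) (Sum.elim lZ lC (σ r)) : ℝ) =
      ∑ r, (G.dist ((Sum.elim lZ lR ∘ eR) r)
        ((Sum.elim lZ lC ∘ eC) (((eR.trans σ).trans eC.symm) r)) : ℝ) := by
      rw [← eR.sum_comp]
      refine Finset.sum_congr rfl fun r _ => ?_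
      simp
    rw [this]
    refine le_trans (le_of_eq ?_) hσ'
    refine Finset.sum_congr rfl fun r _ => ?_
    congr 2
    · rcases r with r | r <;> rfl
    · rcases σ' r with r | r <;> rfl

end OllivierRicci

/-! ### Dependence of the transport cost on the idleness. -/

namespace OllivierRicci

variable {V : Type*} {G : SimpleGraph V} [G.LocallyFinite] {x y : V}

/-- Unit masses on the neighbours of `x` together with a mass `a` on `x`. -/
noncomputable def starMeasure (G : SimpleGraph V) [G.LocallyFinite] (x : V) (a : ℝ) : V →₀ ℝ :=
  ∑ y ∈ G.neighborFinset x, Finsupp.single y 1 + Finsupp.single x a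

theorem starMeasure_add (a b : ℝ) :
    starMeasure G x (a + b) = starMeasure G x a + Finsupp.single x b := by
  rw [starMeasure, starMeasure, Finsupp.single_add, add_assoc]

theorem starMeasure_convex_comb {r s : ℝ} (h : r + s = 1) (a b : ℝ) :
    starMeasure G x (r * a + s * b) = r • starMeasure G x a + s • starMeasure G x b := by
  have e : ∀ t : V →₀ ℝ, t = r • t + s • t := fun t => by rw [← add_smul, h, one_smul]
  simp only [starMeasure, smul_add, Finsupp.single_add, Finsupp.smul_single, smul_eq_mul]
  nth_rewrite 1 [e (∑ y ∈ G.neighborFinset x, Finsupp.single y 1)]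
  abel

theorem starMeasure_eq_sum_option [DecidableEq V] (a : ℝ) :
    starMeasure G x a = ∑ r : Option (G.neighborFinset x),
      Finsupp.single (r.elim x Subtype.val) (if r = none then a else 1) := by
  rw [Fintype.sum_option, starMeasure, add_comm]
  simp [Finset.sum_attach (G.neighborFinset x) fun y => Finsupp.single y (1 : ℝ)]

theorem starMeasure_zero :
    starMeasure G x 0 = ∑ r : G.neighborFinset x, Finsupp.single r.1 1 := by
  rw [starMeasure, Finsupp.single_zero, add_zero,
    Finset.sum_coe_sort (G.neighborFinset x) fun y => Finsupp.single y (1 : ℝ)]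

theorem reachable_of_mem_neighborFinset {z : V} (hz : z ∈ G.neighborFinset x) : G.Reachable x z :=
  ((G.mem_neighborFinset x z).1 hz).reachable

theorem nonempty_neighborFinset_equiv (hd : G.degree x = G.degree y) :
    Nonempty (G.neighborFinset x ≃ G.neighborFinset y) :=
  ⟨Finset.equivOfCardEq hd⟩

/-- Equal degrees let the neighbours be matched, and the central mass moves along the edge. Needed
throughout so that the infimum is never the default value of an empty set. -/
theorem exists_transportable_starMeasure (hd : G.degree x = G.degree y) (hxy : G.Adj x y)
    {a : ℝ} (ha : 0 ≤ a) :
    ∃ c, Transportable G (starMeasure G x a) (starMeasure G y a) c := by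
  obtain ⟨e⟩ := nonempty_neighborFinset_equiv hd
  have h0 := Transportable.of_equiv e fun r c =>
    (reachable_of_mem_neighborFinset r.2).symm.trans
      (hxy.reachable.trans (reachable_of_mem_neighborFinset c.2))
  rw [← starMeasure_zero, ← starMeasure_zero] at h0
  rw [← zero_add a, starMeasure_add, starMeasure_add]
  exact ⟨_, h0.add (Transportable.single hxy.reachable ha)⟩

omit [G.LocallyFinite] in
theorem dist_eq_one (hxy : G.Adj x y) : (G.dist x y : ℝ) = 1 := by
  exact_mod_cast SimpleGraph.dist_eq_one_iff_adj.2 hxy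

omit [G.LocallyFinite] in
theorem transportCost_single_le (hxy : G.Adj x y) {a : ℝ} (ha : 0 ≤ a) :
    transportCost G (Finsupp.single x a) (Finsupp.single y a) ≤ a := by
  have := transportCost_le (Transportable.single hxy.reachable ha)
  rwa [dist_eq_one hxy, mul_one] at this

theorem transportCost_starMeasure_add_le (hd : G.degree x = G.degree y) (hxy : G.Adj x y)
    {a b : ℝ} (ha : 0 ≤ a) (hb : 0 ≤ b) :
    transportCost G (starMeasure G x (a + b)) (starMeasure G y (a + b)) ≤
      transportCost G (starMeasure G x a) (starMeasure G y a) + b := by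
  rw [starMeasure_add, starMeasure_add]
  refine (transportCost_add_le (exists_transportable_starMeasure hd hxy ha)
    ⟨_, Transportable.single hxy.reachable hb⟩).trans ?_
  exact add_le_add le_rfl (transportCost_single_le hxy hb)

theorem transportCost_starMeasure_convex (hd : G.degree x = G.degree y) (hxy : G.Adj x y)
    {a b r s : ℝ} (ha : 0 ≤ a) (hb : 0 ≤ b) (hr : 0 ≤ r) (hs : 0 ≤ s) (hrs : r + s = 1) :
    transportCost G (starMeasure G x (r * a + s * b)) (starMeasure G y (r * a + s * b)) ≤
      r * transportCost G (starMeasure G x a) (starMeasure G y a) +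
      s * transportCost G (starMeasure G x b) (starMeasure G y b) := by
  rw [starMeasure_convex_comb hrs, starMeasure_convex_comb hrs, ← transportCost_smul hr,
    ← transportCost_smul hs]
  obtain ⟨c, hc⟩ := exists_transportable_starMeasure hd hxy ha
  obtain ⟨c', hc'⟩ := exists_transportable_starMeasure hd hxy hb
  exact transportCost_add_le ⟨_, hc.smul hr⟩ ⟨_, hc'.smul hs⟩

/-- Below the uniform distribution on balls, the transport cost is affine in the idleness. -/
theorem transportCost_starMeasure_of_le_one (hd : G.degree x = G.degree y) (hxy : G.Adj x y)
    {a : ℝ} (ha0 : 0 ≤ a) (ha1 : a ≤ 1) :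
    transportCost G (starMeasure G x a) (starMeasure G y a) =
      (1 - a) * transportCost G (starMeasure G x 0) (starMeasure G y 0) +
      a * transportCost G (starMeasure G x 1) (starMeasure G y 1) := by
  classical
  apply le_antisymm
  · have := transportCost_starMeasure_convex hd hxy le_rfl zero_le_one (sub_nonneg.2 ha1) ha0
      (sub_add_cancel 1 a)
    simpa using this
  refine le_transportCost (exists_transportable_starMeasure hd hxy ha0) fun c hc => ?_
  obtain ⟨e⟩ := nonempty_neighborFinset_equiv hd
  rw [starMeasure_eq_sum_option, starMeasure_eq_sum_option] at hc
  have hreach : ∀ (r : Option (G.neighborFinset x)) (c : Option (G.neighborFinset y)),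
      G.Reachable (r.elim x Subtype.val) (c.elim y Subtype.val) := by
    have h1 : ∀ r : Option (G.neighborFinset x), G.Reachable x (r.elim x Subtype.val) := by
      rintro (_ | r)
      · exact .refl _
      · exact reachable_of_mem_neighborFinset r.2
    have h2 : ∀ r : Option (G.neighborFinset y), G.Reachable y (r.elim y Subtype.val) := by
      rintro (_ | r)
      · exact .refl _
      · exact reachable_of_mem_neighborFinset r.2
    exact fun r c => (h1 r).symm.trans (hxy.reachable.trans (h2 c))
  -- A bijection matching the centres pays 1 for the edge and at least the cost at idleness 0 for
  -- the rest, hence `L₀`. Any other bijection is still a plan at idleness 1, hence `L₁`. The 1 in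
  -- `L₀` cancels against the added mass at (x, y).
  have key := Transportable.le_of_forall_equiv (r₀ := none) (c₀ := none) e.optionCongr ha0 ha1
    (L₁ := transportCost G (starMeasure G x 1) (starMeasure G y 1))
    (L₀ := transportCost G (starMeasure G x 0) (starMeasure G y 0) + 1) ?_ ?_ ?_ hc
  · simp only [Option.elim_none, dist_eq_one hxy] at key
    linarith
  · simpa using transportCost_starMeasure_add_le hd hxy le_rfl zero_le_one
  · intro σ
    refine transportCost_le ?_
    rw [starMeasure_eq_sum_option, starMeasure_eq_sum_option]
    simpa using Transportable.of_equiv σ hreach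
  · intro σ hσ
    rw [Fintype.sum_option, hσ, add_comm]
    refine add_le_add (dist_eq_one hxy).ge ?_
    have : ∀ r, σ (some r) = some (Equiv.removeNone σ r) := fun r => by
      refine (Equiv.removeNone_some σ ?_).symm
      rcases hr : σ (some r) with _ | c
      · exact absurd (σ.injective (hr.trans hσ.symm)) (by simp)
      · exact ⟨c, rfl⟩
    simp only [this, Option.elim_some]
    refine transportCost_le ?_
    rw [starMeasure_zero, starMeasure_zero]
    exact Transportable.of_equiv _ fun r c => hreach (some r) (some c)

theorem starMeasure_eq_sum_insert [DecidableEq V] (a : ℝ) :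
    starMeasure G x a =
      ∑ z ∈ insert x (G.neighborFinset x), Finsupp.single z 1 + Finsupp.single x (a - 1) := by
  rw [Finset.sum_insert (by simp), starMeasure,
    add_comm (Finsupp.single x (1 : ℝ)), add_assoc, ← Finsupp.single_add, add_sub_cancel]

theorem starMeasure_eq_sum_closed [DecidableEq V] (B : Finset V) (a : ℝ) :
    starMeasure G x a =
      (∑ z ∈ insert x (G.neighborFinset x) ∩ B, Finsupp.single z 1 +
        ∑ z ∈ insert x (G.neighborFinset x) \ B, Finsupp.single z 1) +
      Finsupp.single x (a - 1) := by
  rw [Finset.sum_inter_add_sum_sdiff, Finset.sum_insert (by simp), starMeasure,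
    add_comm (Finsupp.single x (1 : ℝ)), add_assoc, ← Finsupp.single_add, add_sub_cancel]

omit [G.LocallyFinite] in
/-- Moving a mass directly from `x` to `y` does not hurt. -/
theorem le_sum_dist_option_equiv {P Q : Type*} [Fintype P] [Fintype Q] {lP : P → V} {lQ : Q → V}
    (hxy : G.Adj x y) (hP : ∀ p, G.Adj x (lP p)) (hQ : ∀ q, G.Adj y (lQ q))
    (hPy : ∀ p, lP p ≠ y ∧ ¬ G.Adj y (lP p)) (hQx : ∀ q, lQ q ≠ x ∧ ¬ G.Adj x (lQ q))
    (τ : Option P ≃ Option Q) :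
    ∃ ρ : P ≃ Q, ∑ p, (G.dist (lP p) (lQ (ρ p)) : ℝ) + 1 ≤
      ∑ r, (G.dist (r.elim x lP) ((τ r).elim y lQ) : ℝ) := by
  classical
  refine ⟨Equiv.removeNone τ, ?_⟩
  have hsome : ∀ p, τ (some p) ≠ none → some (Equiv.removeNone τ p) = τ (some p) := fun p hp =>
    Equiv.removeNone_some τ (Option.ne_none_iff_exists'.1 hp)
  rw [Fintype.sum_option, add_comm]
  rcases hn : τ none with _ | q
  · simp only [Option.elim_none, Option.elim_some]
    refine add_le_add (dist_eq_one hxy).ge (le_of_eq (Finset.sum_congr rfl fun p _ => ?_))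
    rw [← hsome p fun h => by simpa using τ.injective (h.trans hn.symm), Option.elim_some]
  · obtain ⟨p₁, hp₁⟩ : ∃ p₁, τ (some p₁) = none := by
      rcases h' : τ.symm none with _ | p₁
      · have : τ none = none := by rw [← h', τ.apply_symm_apply]
        simp [hn] at this
      · exact ⟨p₁, by rw [← h', τ.apply_symm_apply]⟩
    have hq : Equiv.removeNone τ p₁ = q :=
      Option.some_injective _ ((Equiv.removeNone_none τ hp₁).trans hn)
    rw [← Finset.add_sum_erase _ _ (Finset.mem_univ p₁),
      ← Finset.add_sum_erase (a := p₁) _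
        (fun r => (G.dist ((some r).elim x lP) ((τ (some r)).elim y lQ) : ℝ))
        (Finset.mem_univ p₁), ← add_assoc, ← add_assoc, hq, hp₁]
    simp only [Option.elim_none, Option.elim_some]
    refine add_le_add ?_ (le_of_eq (Finset.sum_congr rfl fun p hp => ?_))
    -- The two moves x → q and p₁ → y cost at least 2 each, while x → y costs 1 and p₁ → q at most
    -- 3, via x and y.
    · have h1 : 1 < G.dist x (lQ q) := SimpleGraph.Reachable.one_lt_dist_of_ne_of_not_adj
        (hxy.reachable.trans (hQ q).reachable) (hQx q).1.symm (hQx q).2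
      have h2 : 1 < G.dist (lP p₁) y := SimpleGraph.Reachable.one_lt_dist_of_ne_of_not_adj
        ((hP p₁).symm.reachable.trans hxy.reachable) (hPy p₁).1 fun h => (hPy p₁).2 h.symm
      have h3 : G.dist (lP p₁) (lQ q) ≤ 3 :=
        SimpleGraph.dist_le (.cons (hP p₁).symm (.cons hxy (.cons (hQ q) .nil)))
      have : 1 + G.dist (lP p₁) (lQ q) ≤ G.dist x (lQ q) + G.dist (lP p₁) y := by omega
      exact_mod_cast this
    · rw [← hsome p fun h => Finset.ne_of_mem_erase hp
        (Option.some_injective _ (τ.injective (h.trans hp₁.symm))), Option.elim_some]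

/-- View the measures as the two closed balls plus an extra mass a - 1 ≤ 1 at the centre. Once the
intersection of the balls is cancelled, the extra unit in any bijection may be assumed to go
straight from x to y. The bound a ≤ 2 keeps the extra weight within the range of the matching lemma.
-/
theorem transportCost_starMeasure_ge_of_le_two (hd : G.degree x = G.degree y) (hxy : G.Adj x y)
    {a : ℝ} (ha1 : 1 ≤ a) (ha2 : a ≤ 2) :
    transportCost G (starMeasure G x 1) (starMeasure G y 1) + (a - 1) ≤
      transportCost G (starMeasure G x a) (starMeasure G y a) := by
  classical
  refine le_transportCost (exists_transportable_starMeasure hd hxy (by linarith)) fun c hc => ?_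
  set Bx := insert x (G.neighborFinset x) with hBx
  set By := insert y (G.neighborFinset y) with hBy
  have hmx : ∀ {z}, z ∈ Bx ↔ z = x ∨ G.Adj x z := by simp [hBx]
  have hmy : ∀ {z}, z ∈ By ↔ z = y ∨ G.Adj y z := by simp [hBy]
  have hcard : Bx.card = By.card := by
    rw [hBx, hBy, Finset.card_insert_of_notMem (by simp), Finset.card_insert_of_notMem (by simp),
      G.card_neighborFinset_eq_degree, G.card_neighborFinset_eq_degree, hd]
  let e : ↥(Bx \ By) ≃ ↥(By \ Bx) := Finset.equivOfCardEq (Finset.card_sdiff_comm hcard)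
  have hrx : ∀ z ∈ Bx, G.Reachable x z := fun z hz => by
    rcases hmx.1 hz with rfl | h
    · exact .refl _
    · exact h.reachable
  have hry : ∀ z ∈ By, G.Reachable x z := fun z hz => by
    rcases hmy.1 hz with rfl | h
    · exact hxy.reachable
    · exact hxy.reachable.trans h.reachable
  have hsx : ∀ b, starMeasure G x b = ∑ z : ↥(Bx ∩ By), Finsupp.single z.1 1 +
      ∑ z : ↥(Bx \ By), Finsupp.single z.1 1 + Finsupp.single x (b - 1) := fun b => by
    rw [starMeasure_eq_sum_closed By, Finset.sum_coe_sort _ fun z => Finsupp.single z (1 : ℝ),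
      Finset.sum_coe_sort _ fun z => Finsupp.single z (1 : ℝ)]
  have hsy : ∀ b, starMeasure G y b = ∑ z : ↥(Bx ∩ By), Finsupp.single z.1 1 +
      ∑ z : ↥(By \ Bx), Finsupp.single z.1 1 + Finsupp.single y (b - 1) := fun b => by
    rw [starMeasure_eq_sum_closed Bx, Finset.sum_coe_sort _ fun z => Finsupp.single z (1 : ℝ),
      Finset.sum_coe_sort _ fun z => Finsupp.single z (1 : ℝ), Finset.inter_comm]
  have hlow : ∀ σ : ↥(Bx ∩ By) ⊕ Option ↥(Bx \ By) ≃ ↥(Bx ∩ By) ⊕ Option ↥(By \ Bx),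
      transportCost G (starMeasure G x 1) (starMeasure G y 1) + 1 ≤
        ∑ r, (G.dist (Sum.elim Subtype.val (fun r => r.elim x Subtype.val) r)
          (Sum.elim Subtype.val (fun r => r.elim y Subtype.val) (σ r)) : ℝ) := by
    intro σ
    obtain ⟨τ, hτ⟩ := exists_equiv_of_sum_equiv (G := G) (x := x) (lZ := Subtype.val)
      (lR := fun r : Option ↥(Bx \ By) => r.elim x Subtype.val)
      (lC := fun r : Option ↥(By \ Bx) => r.elim y Subtype.val)
      (fun z => hrx _ (Finset.mem_inter.1 z.2).1)
      (by
        rintro (_ | r)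
        · exact .refl _
        · exact hrx _ (Finset.mem_sdiff.1 r.2).1)
      (by
        rintro (_ | r)
        · exact hxy.reachable
        · exact hry _ (Finset.mem_sdiff.1 r.2).1) σ
    refine le_trans ?_ hτ
    obtain ⟨ρ, hρ⟩ := le_sum_dist_option_equiv (G := G) (lP := fun p : ↥(Bx \ By) => p.1)
      (lQ := fun p : ↥(By \ Bx) => p.1) hxy
      -- The centres lie in both balls, so a point of only one ball is a neighbour of that ball's
      -- centre.
      (fun p => by
        obtain ⟨h1, h2⟩ := Finset.mem_sdiff.1 p.2
        rcases hmx.1 h1 with h | h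
        · exact absurd (hmy.2 (Or.inr (h ▸ hxy.symm))) h2
        · exact h)
      (fun p => by
        obtain ⟨h1, h2⟩ := Finset.mem_sdiff.1 p.2
        rcases hmy.1 h1 with h | h
        · exact absurd (hmx.2 (Or.inr (h ▸ hxy))) h2
        · exact h)
      (fun p => by simpa [hmy, not_or] using (Finset.mem_sdiff.1 p.2).2)
      (fun p => by simpa [hmx, not_or] using (Finset.mem_sdiff.1 p.2).2) τ
    refine le_trans (add_le_add ?_ le_rfl) hρ
    have h1 := Transportable.of_equiv (G := G) ρ (lR := fun p : ↥(Bx \ By) => p.1)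
      (lC := fun p : ↥(By \ Bx) => p.1) fun r c =>
        (hrx _ (Finset.mem_sdiff.1 r.2).1).symm.trans (hry _ (Finset.mem_sdiff.1 c.2).1)
    have h2 := Transportable.sum_single (G := G) (Finset.univ : Finset ↥(Bx ∩ By))
      (f := Subtype.val) (g := Subtype.val) fun _ _ => .refl _
    refine transportCost_le ?_
    have := h2.add h1
    simpa [hsx, hsy] using this
  -- Here every bijection obeys the same bound, so `L₀ = L₁`; only the extra label has reduced
  -- weight.
  have key := Transportable.le_of_forall_equiv (r₀ := Sum.inr none) (c₀ := Sum.inr none)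
    (t := a - 1) (a := c) (G := G)
    ((Equiv.refl ↥(Bx ∩ By)).sumCongr e.optionCongr) (by linarith) (by linarith) le_rfl
    hlow (fun σ _ => hlow σ) (by
      rw [hsx, hsy] at hc
      simp only [Fintype.sum_sum_type, Fintype.sum_option, Sum.elim_inl, Sum.elim_inr,
        Option.elim_none, Option.elim_some, reduceCtorEq, if_false, if_true, Sum.inr.injEq]
      convert hc using 1 <;> abel)
  simp only [Sum.elim_inr, Option.elim_none, dist_eq_one hxy] at key
  linarith

/-- Above the uniform distribution on balls, extra mass is moved from `x` to `y` directly. -/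
theorem transportCost_starMeasure_of_one_le (hd : G.degree x = G.degree y) (hxy : G.Adj x y)
    {a : ℝ} (ha : 1 ≤ a) :
    transportCost G (starMeasure G x a) (starMeasure G y a) =
      transportCost G (starMeasure G x 1) (starMeasure G y 1) + (a - 1) := by
  apply le_antisymm
  · simpa using transportCost_starMeasure_add_le hd hxy zero_le_one (sub_nonneg.2 ha)
  rcases le_or_gt a 2 with ha2 | ha2
  · exact transportCost_starMeasure_ge_of_le_two hd hxy ha ha2
  have h2 := transportCost_starMeasure_ge_of_le_two hd hxy one_le_two le_rfl
  have hpos : 0 < a - 1 := by linarith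
  -- Write 2 as a convex combination of 1 and a: by convexity, the slope already attained on [1, 2]
  -- cannot decrease afterwards.
  have hconv := transportCost_starMeasure_convex hd hxy (a := 1) (b := a) (r := (a - 2) / (a - 1))
    (s := 1 / (a - 1)) zero_le_one (by linarith) (div_nonneg (by linarith) hpos.le)
    (by positivity) (by field_simp; ring)
  rw [show (a - 2) / (a - 1) * 1 + 1 / (a - 1) * a = 2 by field_simp; ring] at hconv
  have h3 := mul_le_mul_of_nonneg_left (h2.trans hconv) hpos.le
  have h4 : ∀ u v : ℝ, (a - 1) * ((a - 2) / (a - 1) * u + 1 / (a - 1) * v) = (a - 2) * u + v := by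
    intro u v; field_simp
  rw [h4] at h3
  linarith

end OllivierRicci

/-! ### Stars in the strong product: fibres and projection. -/

namespace OllivierRicci

section Product

variable {V W : Type*} {G : SimpleGraph V} {H : SimpleGraph W} {x x' : V} {y y' : W}

theorem strongProduct_adj_fiber (G : SimpleGraph V) (H : SimpleGraph W) (k : V) (u v : W)
    (h : H.Adj u v) : (k, u) = (k, v) ∨ (strongProduct G H).Adj (k, u) (k, v) :=
  Or.inr ⟨by simp [h.ne], Or.inl rfl, Or.inr h⟩

theorem strongProduct_adj_snd (G : SimpleGraph V) (H : SimpleGraph W) (p q : V × W)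
    (h : (strongProduct G H).Adj p q) : p.2 = q.2 ∨ H.Adj p.2 q.2 :=
  h.2.2.imp Eq.symm id

variable [G.LocallyFinite] [H.LocallyFinite]

theorem insert_neighborFinset_strongProduct [DecidableEq V] [DecidableEq W] (p : V × W) :
    insert p ((strongProduct G H).neighborFinset p) =
      insert p.1 (G.neighborFinset p.1) ×ˢ insert p.2 (H.neighborFinset p.2) := by
  ext q
  by_cases h : q = p
  · simp [h]
  · rw [Finset.mem_insert, or_iff_right h, SimpleGraph.mem_neighborFinset]
    simp [strongProduct, closedNeighborSet, Ne.symm h]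

theorem degree_strongProduct (p : V × W) :
    (strongProduct G H).degree p =
      G.degree p.1 + H.degree p.2 + G.degree p.1 * H.degree p.2 := by
  classical
  have := congrArg Finset.card (insert_neighborFinset_strongProduct (G := G) (H := H) p)
  rw [Finset.card_product, Finset.card_insert_of_notMem (by simp),
    Finset.card_insert_of_notMem (by simp), Finset.card_insert_of_notMem (by simp),
    SimpleGraph.card_neighborFinset_eq_degree, SimpleGraph.card_neighborFinset_eq_degree,
    SimpleGraph.card_neighborFinset_eq_degree] at this
  linarith

/-- Closed balls in the strong product are products of closed balls, so the star is one uniform ball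
per fibre, corrected at the single atom (x, y). -/
theorem starMeasure_strongProduct [DecidableEq V] (a : ℝ) :
    starMeasure (strongProduct G H) (x, y) a =
      ∑ k ∈ insert x (G.neighborFinset x), (starMeasure H y 1).mapDomain (Prod.mk k) +
        Finsupp.single (x, y) (a - 1) := by
  classical
  rw [starMeasure_eq_sum_insert, insert_neighborFinset_strongProduct, Finset.sum_product]
  congr 1
  refine Finset.sum_congr rfl fun k _ => ?_
  rw [starMeasure_eq_sum_insert, sub_self, Finsupp.single_zero, add_zero,
    Finsupp.mapDomain_finsetSum]
  simp

/-- The deg x + 1 fibres project to the same ball; relative to this multiplicity, the correction a -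
1 changes the idleness 1 by (a - 1)/(deg x + 1). -/
theorem mapDomain_snd_starMeasure (a : ℝ) :
    (starMeasure (strongProduct G H) (x, y) a).mapDomain Prod.snd =
      ((G.degree x : ℝ) + 1) • starMeasure H y ((G.degree x + a) / (G.degree x + 1)) := by
  classical
  have hm : (G.degree x : ℝ) + 1 ≠ 0 := by positivity
  have e : ∀ k : V, ((starMeasure H y 1).mapDomain (Prod.mk k)).mapDomain Prod.snd =
      starMeasure H y 1 := fun k => by
    rw [← Finsupp.mapDomain_comp]
    exact Finsupp.mapDomain_id
  rw [starMeasure_strongProduct, Finsupp.mapDomain_add, Finsupp.mapDomain_finsetSum,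
    Finset.sum_congr rfl fun k _ => e k, Finset.sum_const,
    Finset.card_insert_of_notMem (by simp), G.card_neighborFinset_eq_degree,
    show ((G.degree x : ℝ) + a) / (G.degree x + 1) = 1 + (a - 1) / (G.degree x + 1) by
      field_simp; ring,
    starMeasure_add, smul_add, Finsupp.smul_single, smul_eq_mul, mul_div_cancel₀ _ hm,
    Finsupp.mapDomain_single, ← Nat.cast_smul_eq_nsmul ℝ]
  push_cast
  rfl

theorem insert_neighborFinset_eq [DecidableEq V]
    (hx : closedNeighborSet G x = closedNeighborSet G x') :
    insert x (G.neighborFinset x) = insert x' (G.neighborFinset x') := by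
  ext z
  have := Set.ext_iff.1 hx z
  simpa [closedNeighborSet] using this

theorem degree_eq_of_closedNeighborSet_eq (hx : closedNeighborSet G x = closedNeighborSet G x') :
    G.degree x = G.degree x' := by
  classical
  have := congrArg Finset.card (insert_neighborFinset_eq hx)
  rw [Finset.card_insert_of_notMem (by simp), Finset.card_insert_of_notMem (by simp)] at this
  simpa using this

omit [G.LocallyFinite] [H.LocallyFinite] in
theorem strongProduct_adj_of_closedNeighborSet_eq
    (hx : closedNeighborSet G x = closedNeighborSet G x') (hy : H.Adj y y') :
    (strongProduct G H).Adj (x, y) (x', y') :=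
  ⟨by simp [hy.ne], hx ▸ Or.inl rfl, Or.inr hy⟩

/-- Projecting to the second factor gives a lower bound for the transport cost. -/
theorem le_transportCost_strongProduct (hx : closedNeighborSet G x = closedNeighborSet G x')
    (hd : H.degree y = H.degree y') (hy : H.Adj y y') {a : ℝ} (ha : 0 ≤ a) :
    ((G.degree x : ℝ) + 1) *
      transportCost H (starMeasure H y ((G.degree x + a) / (G.degree x + 1)))
        (starMeasure H y' ((G.degree x + a) / (G.degree x + 1))) ≤
      transportCost (strongProduct G H) (starMeasure (strongProduct G H) (x, y) a)
        (starMeasure (strongProduct G H) (x', y') a) := by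
  have hdx := degree_eq_of_closedNeighborSet_eq hx
  refine le_transportCost (exists_transportable_starMeasure
    (by simp only [degree_strongProduct, hdx, hd])
    (strongProduct_adj_of_closedNeighborSet_eq hx hy) ha) fun c hc => ?_
  rw [← transportCost_smul (by positivity)]
  have := hc.map (strongProduct_adj_snd G H)
  rw [mapDomain_snd_starMeasure, mapDomain_snd_starMeasure, ← hdx] at this
  exact transportCost_le this

/-- At idleness 1 both stars have full balls over the same set of fibres, so one plan of H is copied
into each fibre. -/
theorem transportCost_strongProduct_one_le (hx : closedNeighborSet G x = closedNeighborSet G x')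
    (hd : H.degree y = H.degree y') (hy : H.Adj y y') :
    transportCost (strongProduct G H) (starMeasure (strongProduct G H) (x, y) 1)
        (starMeasure (strongProduct G H) (x', y') 1) ≤
      ((G.degree x : ℝ) + 1) * transportCost H (starMeasure H y 1) (starMeasure H y' 1) := by
  classical
  rw [← div_le_iff₀' (by positivity)]
  refine le_transportCost (exists_transportable_starMeasure hd hy zero_le_one) fun c hc => ?_
  rw [div_le_iff₀' (by positivity)]
  refine transportCost_le ?_
  have := Transportable.sum (insert x (G.neighborFinset x))
    fun k _ => hc.map (strongProduct_adj_fiber G H k)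
  rw [starMeasure_strongProduct, starMeasure_strongProduct, ← insert_neighborFinset_eq hx]
  rw [Finset.sum_const, Finset.card_insert_of_notMem (by simp),
    G.card_neighborFinset_eq_degree, nsmul_eq_mul] at this
  simpa using this

end Product

/-! ### Exact transport costs in the strong product at idleness 0 and 1. -/

section Twins

variable {W : Type*} {H : SimpleGraph W} [H.LocallyFinite] {y y' : W}

/-- A mass on a common neighbour can be taken out of both balls. -/
theorem exists_transportable_of_starMeasure_one [DecidableEq W] (hd : H.degree y = H.degree y')
    (hy : H.Adj y y') {c : ℝ} (hc : Transportable H (starMeasure H y 1) (starMeasure H y' 1) c) :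
    Transportable H (∑ z ∈ (insert y (H.neighborFinset y)).erase y', Finsupp.single z 1)
      (starMeasure H y' 0) c := by
  set R := (insert y (H.neighborFinset y)).erase y' with hR
  have hcard : R.card = (H.neighborFinset y').card := by
    rw [hR, Finset.card_erase_of_mem (by simp [hy]), Finset.card_insert_of_notMem (by simp),
      H.card_neighborFinset_eq_degree, H.card_neighborFinset_eq_degree, hd, Nat.add_sub_cancel]
  let e : R ≃ H.neighborFinset y' := Finset.equivOfCardEq hcard
  have hRr : ∀ r : Option R, H.Reachable y' (r.elim y' Subtype.val) := by
    rintro (_ | ⟨r, hr⟩)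
    · exact .refl _
    · rcases Finset.mem_insert.1 (Finset.mem_of_mem_erase hr) with rfl | h
      · exact hy.symm.reachable
      · exact hy.symm.reachable.trans (reachable_of_mem_neighborFinset h)
  have hCr : ∀ r : Option (H.neighborFinset y'), H.Reachable y' (r.elim y' Subtype.val) := by
    rintro (_ | r)
    · exact .refl _
    · exact reachable_of_mem_neighborFinset r.2
  have hreach := fun r c => (hRr r).symm.trans (hCr c)
  have h1 : starMeasure H y 1 =
      ∑ r : Option R, Finsupp.single (r.elim y' Subtype.val) (1 : ℝ) := by
    rw [starMeasure_eq_sum_insert, sub_self, Finsupp.single_zero, add_zero, Fintype.sum_option,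
      ← Finset.add_sum_erase _ _ (show y' ∈ insert y (H.neighborFinset y) by simp [hy])]
    congr 1
    exact (Finset.sum_coe_sort R fun z => Finsupp.single z (1 : ℝ)).symm
  rw [h1, starMeasure_eq_sum_option] at hc
  simp only [ite_self] at hc
  obtain ⟨σ, hσ⟩ := hc.exists_equiv e.optionCongr
  -- The label `none` denotes y' on both sides, so it can be cancelled.
  obtain ⟨τ, hτ⟩ := exists_equiv_of_option_equiv hreach rfl σ
  have := (Transportable.of_equiv τ fun r c => hreach (some r) (some c)).mono (hτ.trans hσ)
  simp only [Option.elim_some] at this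
  rwa [← starMeasure_zero, Finset.sum_coe_sort R fun z => Finsupp.single z (1 : ℝ)] at this

/-- The mass on the neighbour `y'` of `y` can be sent to a single neighbour of `y'`. -/
theorem exists_transportable_of_starMeasure_zero [DecidableEq W] (hd : H.degree y = H.degree y')
    (hy : H.Adj y y') {c : ℝ} (hc : Transportable H (starMeasure H y 0) (starMeasure H y' 0) c) :
    ∃ (w : W) (ν : W →₀ ℝ), H.Adj y' w ∧ ν + Finsupp.single w 1 = starMeasure H y' 0 ∧
      Transportable H (∑ z ∈ (H.neighborFinset y).erase y', Finsupp.single z 1) ν (c - 1) := by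
  obtain ⟨e⟩ := nonempty_neighborFinset_equiv hd
  rw [starMeasure_zero, starMeasure_zero] at hc
  obtain ⟨σ, hσ⟩ := hc.exists_equiv e
  let r₀ : H.neighborFinset y := ⟨y', by simpa using hy⟩
  have hw : H.Adj y' (σ r₀) := (H.mem_neighborFinset _ _).1 (σ r₀).2
  refine ⟨σ r₀, ∑ r ∈ Finset.univ.erase r₀, Finsupp.single (σ r).1 1, hw, ?_, ?_⟩
  · rw [Finset.sum_erase_add _ _ (Finset.mem_univ _), starMeasure_zero]
    exact σ.sum_comp fun c => Finsupp.single c.1 (1 : ℝ)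
  · have h := Transportable.sum_single (G := H) (Finset.univ.erase r₀) (f := Subtype.val)
      (g := fun r => (σ r).1) fun r _ => (reachable_of_mem_neighborFinset r.2).symm.trans
        (hy.reachable.trans (reachable_of_mem_neighborFinset (σ r).2))
    have e1 : ∑ r ∈ Finset.univ.erase r₀, Finsupp.single r.1 (1 : ℝ) =
        ∑ z ∈ (H.neighborFinset y).erase y', Finsupp.single z 1 := by
      have h1 := Finset.sum_erase_add (a := r₀) Finset.univ
        (fun r : H.neighborFinset y => Finsupp.single r.1 (1 : ℝ)) (Finset.mem_univ _)
      have h2 := Finset.sum_erase_add (a := y') (H.neighborFinset y)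
        (fun z => Finsupp.single z (1 : ℝ)) r₀.2
      rw [← Finset.sum_coe_sort (H.neighborFinset y), ← h1] at h2
      exact (add_right_cancel h2).symm
    rw [e1] at h
    refine h.mono ?_
    rw [← Finset.add_sum_erase _ _ (Finset.mem_univ r₀)] at hσ
    have : (H.dist r₀.1 (σ r₀).1 : ℝ) = 1 := dist_eq_one hw
    linarith

variable {V : Type*} {G : SimpleGraph V} [G.LocallyFinite] {x x' : V}

omit [G.LocallyFinite] in
-- In the fibre of x, leave the mass at y' in place instead of sending it to a neighbour w of y';
-- this saves 1 and leaves (x, w) unfilled. In the fibre of x', drop y' from both balls, which costs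
-- nothing extra. The freed mass at (x', y') fills the adjacent (x, w) at cost 1, using up the
-- saving.
theorem transportable_fiber_pair (hx : G.Adj x x') (hd : H.degree y = H.degree y')
    (hy : H.Adj y y') {c₀ c₁ : ℝ}
    (hc₀ : Transportable H (starMeasure H y 0) (starMeasure H y' 0) c₀)
    (hc₁ : Transportable H (starMeasure H y 1) (starMeasure H y' 1) c₁) :
    Transportable (strongProduct G H)
      ((starMeasure H y 0).mapDomain (Prod.mk x) + (starMeasure H y 1).mapDomain (Prod.mk x'))
      ((starMeasure H y' 1).mapDomain (Prod.mk x) + (starMeasure H y' 0).mapDomain (Prod.mk x'))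
      (c₀ + c₁) := by
  classical
  obtain ⟨w, ν, hw, hν, hT₀⟩ := exists_transportable_of_starMeasure_zero hd hy hc₀
  have hT₁ := exists_transportable_of_starMeasure_one hd hy hc₁
  have h1 := hT₀.map (strongProduct_adj_fiber G H x)
  have h2 := Transportable.single (G := strongProduct G H) (x := (x, y')) (.refl _) zero_le_one
  have hadj : (strongProduct G H).Adj (x', y') (x, w) :=
    ⟨by simp [hw.ne], Or.inr hx.symm, Or.inr hw⟩
  have h3 := Transportable.single hadj.reachable zero_le_one
  rw [dist_eq_one hadj] at h3
  have h4 := hT₁.map (strongProduct_adj_fiber G H x')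
  have e1 : starMeasure H y 0 =
      ∑ z ∈ (H.neighborFinset y).erase y', Finsupp.single z 1 + Finsupp.single y' 1 := by
    rw [Finset.sum_erase_add _ _ (by simpa using hy), starMeasure, Finsupp.single_zero, add_zero]
  have e2 : starMeasure H y 1 =
      ∑ z ∈ (insert y (H.neighborFinset y)).erase y', Finsupp.single z 1 +
        Finsupp.single y' 1 := by
    rw [Finset.sum_erase_add _ _ (by simp [hy]), starMeasure_eq_sum_insert, sub_self,
      Finsupp.single_zero, add_zero]
  have e3 : starMeasure H y' 1 = ν + Finsupp.single w 1 + Finsupp.single y' 1 := by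
    rw [hν, ← starMeasure_add, zero_add]
  rw [e1, e2, e3]
  simp only [Finsupp.mapDomain_add, Finsupp.mapDomain_single] at h1 h4 ⊢
  convert ((h1.add h2).add h3).add h4 using 1
  · abel
  · abel
  · simp only [SimpleGraph.dist_self, Nat.cast_zero, mul_zero, mul_one]; ring

/-- If x = x', both missing atoms lie in one fibre, which uses a plan for idleness 0 while the
others use one for idleness 1. If x ≠ x', the fibres of x and x' are treated together as a pair. -/
theorem transportCost_strongProduct_zero_le (hx : closedNeighborSet G x = closedNeighborSet G x')
    (hd : H.degree y = H.degree y') (hy : H.Adj y y') :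
    transportCost (strongProduct G H) (starMeasure (strongProduct G H) (x, y) 0)
        (starMeasure (strongProduct G H) (x', y') 0) ≤
      transportCost H (starMeasure H y 0) (starMeasure H y' 0) +
        G.degree x * transportCost H (starMeasure H y 1) (starMeasure H y' 1) := by
  classical
  have hstar : ∀ (u : V) (v : W), (starMeasure H v 1).mapDomain (Prod.mk u) +
      Finsupp.single (u, v) (0 - 1) = (starMeasure H v 0).mapDomain (Prod.mk u) := fun u v => by
    have := starMeasure_add (G := H) (x := v) 1 (-1)
    rw [add_neg_cancel] at this
    rw [this, Finsupp.mapDomain_add, Finsupp.mapDomain_single, zero_sub]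
  have key : ∀ c₀ c₁, Transportable H (starMeasure H y 0) (starMeasure H y' 0) c₀ →
      Transportable H (starMeasure H y 1) (starMeasure H y' 1) c₁ →
      Transportable (strongProduct G H) (starMeasure (strongProduct G H) (x, y) 0)
        (starMeasure (strongProduct G H) (x', y') 0) (c₀ + G.degree x * c₁) := by
    intro c₀ c₁ hc₀ hc₁
    set K := insert x (G.neighborFinset x) with hK
    have hKcard : K.card = G.degree x + 1 := by
      rw [hK, Finset.card_insert_of_notMem (by simp), G.card_neighborFinset_eq_degree]
    have hxK : x ∈ K := by simp [hK]
    rw [starMeasure_strongProduct, starMeasure_strongProduct, ← insert_neighborFinset_eq hx, ← hK]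
    by_cases hxx : x = x'
    · subst hxx
      rw [← Finset.sum_erase_add _ _ hxK, ← Finset.sum_erase_add _ _ hxK, add_assoc, add_assoc,
        hstar, hstar]
      convert (Transportable.sum (K.erase x)
        fun k _ => hc₁.map (strongProduct_adj_fiber G H k)).add
          (hc₀.map (strongProduct_adj_fiber G H x)) using 1
      rw [Finset.sum_const, Finset.card_erase_of_mem hxK, hKcard, Nat.add_sub_cancel,
        nsmul_eq_mul, add_comm]
    · have hadj : G.Adj x x' := by
        have : x' ∈ closedNeighborSet G x := hx ▸ Or.inl rfl
        exact this.resolve_left fun h => hxx h.symm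
      have hxK' : x' ∈ K.erase x := by simp [hK, hadj]
      rw [← Finset.sum_erase_add _ _ hxK, ← Finset.sum_erase_add _ _ hxK,
        ← Finset.sum_erase_add _ _ hxK', ← Finset.sum_erase_add _ _ hxK']
      have hdeg : 1 ≤ G.degree x := (G.degree_pos_iff_exists_adj x).2 ⟨x', hadj⟩
      convert (Transportable.sum ((K.erase x).erase x')
        fun k _ => hc₁.map (strongProduct_adj_fiber G H k)).add
          (transportable_fiber_pair hadj hd hy hc₀ hc₁) using 1
      · rw [← hstar x y]; abel
      · rw [← hstar x' y']; abel
      · rw [Finset.sum_const, Finset.card_erase_of_mem hxK', Finset.card_erase_of_mem hxK, hKcard,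
          Nat.add_sub_cancel, nsmul_eq_mul, Nat.cast_sub hdeg]
        push_cast
        ring
  rw [← sub_le_iff_le_add]
  refine le_transportCost (exists_transportable_starMeasure hd hy le_rfl) fun c₀ hc₀ => ?_
  rw [sub_le_iff_le_add, ← sub_le_iff_le_add']
  -- Passing to the infimum over c₁ divides by the degree; at degree 0 the c₁ term disappears.
  rcases Nat.eq_zero_or_pos (G.degree x) with h0 | hpos
  · obtain ⟨c₁, hc₁⟩ := exists_transportable_starMeasure hd hy zero_le_one
    have := transportCost_le (key c₀ c₁ hc₀ hc₁)
    simp only [h0, Nat.cast_zero, zero_mul] at this ⊢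
    linarith
  · have hpos' : (0 : ℝ) < G.degree x := by exact_mod_cast hpos
    rw [← div_le_iff₀' hpos']
    refine le_transportCost (exists_transportable_starMeasure hd hy zero_le_one) fun c₁ hc₁ => ?_
    rw [div_le_iff₀' hpos', sub_le_iff_le_add']
    exact transportCost_le (key c₀ c₁ hc₀ hc₁)

theorem transportCost_strongProduct_one (hx : closedNeighborSet G x = closedNeighborSet G x')
    (hd : H.degree y = H.degree y') (hy : H.Adj y y') :
    transportCost (strongProduct G H) (starMeasure (strongProduct G H) (x, y) 1)
        (starMeasure (strongProduct G H) (x', y') 1) =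
      ((G.degree x : ℝ) + 1) * transportCost H (starMeasure H y 1) (starMeasure H y' 1) := by
  refine (transportCost_strongProduct_one_le hx hd hy).antisymm ?_
  have := le_transportCost_strongProduct hx hd hy zero_le_one
  rwa [div_self (by positivity)] at this

theorem transportCost_strongProduct_zero (hx : closedNeighborSet G x = closedNeighborSet G x')
    (hd : H.degree y = H.degree y') (hy : H.Adj y y') :
    transportCost (strongProduct G H) (starMeasure (strongProduct G H) (x, y) 0)
        (starMeasure (strongProduct G H) (x', y') 0) =
      transportCost H (starMeasure H y 0) (starMeasure H y' 0) +
        G.degree x * transportCost H (starMeasure H y 1) (starMeasure H y' 1) := by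
  refine (transportCost_strongProduct_zero_le hx hd hy).antisymm ?_
  have h := le_transportCost_strongProduct hx hd hy le_rfl
  have hm : (0 : ℝ) < G.degree x + 1 := by positivity
  -- The projected idleness deg x/(deg x + 1) lies in [0, 1], where the cost in H is affine.
  rw [add_zero, transportCost_starMeasure_of_le_one hd hy (by positivity)
    ((div_le_one hm).2 (by linarith))] at h
  refine le_trans (le_of_eq ?_) h
  field_simp
  ring

end Twins

end OllivierRicci

/-! ### From transport costs to curvatures. -/

namespace OllivierRicci

variable {V : Type*} {G : SimpleGraph V} [G.LocallyFinite] {x y : V}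

theorem starMeasure_apply [DecidableEq V] [DecidableRel G.Adj] (a : ℝ) (z : V) :
    starMeasure G x a z = if z = x then a else if G.Adj x z then 1 else 0 := by
  rw [starMeasure, Finsupp.add_apply, Finsupp.finsetSum_apply]
  simp only [Finsupp.single_apply, Finset.sum_ite_eq', G.mem_neighborFinset]
  by_cases h : z = x
  · simp [h]
  · simp [h, Ne.symm h]

theorem walkMeasure_eq_starMeasure (hx : 0 < G.degree x) {α : ℝ} (hα : α ≠ 1) :
    walkMeasure G α x =
      ⇑(((1 - α) / G.degree x) • starMeasure G x (α * G.degree x / (1 - α))) := by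
  classical
  have h1 : 1 - α ≠ 0 := sub_ne_zero.2 hα.symm
  have h2 : (G.degree x : ℝ) ≠ 0 := by exact_mod_cast hx.ne'
  ext z
  rw [Finsupp.smul_apply, starMeasure_apply, walkMeasure, smul_eq_mul]
  split_ifs
  · field_simp
  · rw [mul_one]
  · rw [mul_zero]

theorem walkMeasure_le_one (G : SimpleGraph V) [G.LocallyFinite] {α : ℝ} (hα0 : 0 ≤ α)
    (hα1 : α ≤ 1) (x z : V) : walkMeasure G α x z ≤ 1 := by
  rw [walkMeasure]
  split_ifs with h1 h2
  · exact hα1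
  · have : (1 : ℝ) ≤ G.degree x := by
      exact_mod_cast (G.degree_pos_iff_exists_adj x).2 ⟨z, h2⟩
    rw [div_le_one (by linarith)]
    linarith
  · exact zero_le_one

theorem ricciCurvature_eq (hd : G.degree x = G.degree y) (hxy : G.Adj x y) {α : ℝ} (hα0 : 0 ≤ α)
    (hα1 : α < 1) :
    ricciCurvature G α x y = 1 - (1 - α) / G.degree x *
      transportCost G (starMeasure G x (α * G.degree x / (1 - α)))
        (starMeasure G y (α * G.degree x / (1 - α))) := by
  have hx : 0 < G.degree x := (G.degree_pos_iff_exists_adj x).2 ⟨y, hxy⟩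
  have h := walkMeasure_eq_starMeasure hx hα1.ne
  rw [ricciCurvature, dist_eq_one hxy, div_one, h,
    walkMeasure_eq_starMeasure (hd ▸ hx) hα1.ne, wasserstein_eq_transportCost _ _ _ fun z => by
      rw [← h]; exact walkMeasure_le_one G hα0 hα1.le x z, ← hd,
    transportCost_smul (div_nonneg (by linarith) (Nat.cast_nonneg _))]

/-- At α = 1 the rescaling to a star breaks down; the measures are point masses at distance 1. -/
theorem ricciCurvature_one (hxy : G.Adj x y) : ricciCurvature G 1 x y = 0 := by
  classical
  have h : ∀ x, walkMeasure G 1 x = ⇑(Finsupp.single x (1 : ℝ)) := fun x => by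
    ext z
    simp [walkMeasure, Finsupp.single_apply, eq_comm]
  rw [ricciCurvature, dist_eq_one hxy, div_one, h, h, wasserstein_eq_transportCost _ _ _ fun z => by
    rw [Finsupp.single_apply]; split_ifs <;> norm_num, sub_eq_zero]
  refine le_antisymm ?_ (transportCost_single_le hxy zero_le_one)
  refine le_transportCost ⟨_, Transportable.single hxy.reachable zero_le_one⟩ fun c hc => ?_
  obtain ⟨σ, hσ⟩ := Transportable.exists_equiv (G := G) (R := Unit) (C := Unit) (Equiv.refl Unit)
    (lR := fun _ => x) (lC := fun _ => y) (a := c) (by simpa using hc)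
  simpa [dist_eq_one hxy] using hσ

theorem ricciCurvature_of_le (hd : G.degree x = G.degree y) (hxy : G.Adj x y) {α : ℝ}
    (hα0 : 0 ≤ α) (hα1 : α ≤ 1 / ((G.degree x : ℝ) + 1)) :
    ricciCurvature G α x y =
      1 - ((1 - α) / G.degree x - α) *
        transportCost G (starMeasure G x 0) (starMeasure G y 0) -
      α * transportCost G (starMeasure G x 1) (starMeasure G y 1) := by
  have hD : (0 : ℝ) < G.degree x := by
    exact_mod_cast (G.degree_pos_iff_exists_adj x).2 ⟨y, hxy⟩
  rw [le_div_iff₀ (by linarith)] at hα1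
  have h1 : 0 < 1 - α := by nlinarith
  rw [ricciCurvature_eq hd hxy hα0 (by linarith), transportCost_starMeasure_of_le_one hd hxy
    (by positivity) ((div_le_one h1).2 (by linarith))]
  field_simp
  ring

theorem ricciCurvature_of_ge (hd : G.degree x = G.degree y) (hxy : G.Adj x y) {α : ℝ}
    (hα0 : 1 / ((G.degree x : ℝ) + 1) ≤ α) (hα1 : α ≤ 1) :
    ricciCurvature G α x y =
      (G.degree x + 1 - transportCost G (starMeasure G x 1) (starMeasure G y 1)) / G.degree x *
        (1 - α) := by
  have hD : (0 : ℝ) < G.degree x := by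
    exact_mod_cast (G.degree_pos_iff_exists_adj x).2 ⟨y, hxy⟩
  rcases hα1.eq_or_lt with rfl | hα1
  · rw [ricciCurvature_one hxy, sub_self, mul_zero]
  have hα : 0 ≤ α := le_trans (by positivity) hα0
  rw [div_le_iff₀ (by linarith)] at hα0
  have h1 : 0 < 1 - α := by linarith
  rw [ricciCurvature_eq hd hxy hα hα1, transportCost_starMeasure_of_one_le hd hxy
    ((one_le_div h1).2 (by linarith))]
  field_simp
  ring

/-- The quotient is constant on [1/(D+1), 1), where D is the degree of x. -/
theorem tendsto_ricciCurvature_div (hd : G.degree x = G.degree y) (hxy : G.Adj x y) :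
    Tendsto (fun α : ℝ => ricciCurvature G α x y / (1 - α)) (𝓝[<] 1)
      (𝓝 ((G.degree x + 1 - transportCost G (starMeasure G x 1) (starMeasure G y 1)) /
        G.degree x)) := by
  have hD : (0 : ℝ) < G.degree x := by
    exact_mod_cast (G.degree_pos_iff_exists_adj x).2 ⟨y, hxy⟩
  refine tendsto_const_nhds.congr' ?_
  have hlt : 1 / ((G.degree x : ℝ) + 1) < 1 := by
    rw [div_lt_one (by linarith)]; linarith
  filter_upwards [Ico_mem_nhdsLT hlt] with α hα
  rw [ricciCurvature_of_ge hd hxy hα.1 hα.2.le, mul_div_cancel_right₀]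
  exact (sub_pos.2 hα.2).ne'

theorem llyCurvature_eq (hd : G.degree x = G.degree y) (hxy : G.Adj x y) :
    llyCurvature G x y =
      (G.degree x + 1 - transportCost G (starMeasure G x 1) (starMeasure G y 1)) /
        G.degree x :=
  (tendsto_ricciCurvature_div hd hxy).limUnder_eq

end OllivierRicci

theorem mainTheorem5 {V W : Type*} (G : SimpleGraph V) (H : SimpleGraph W)
    [G.LocallyFinite] [H.LocallyFinite] (dG dH : ℕ)
    (hG : G.IsRegularOfDegree dG) (hH : H.IsRegularOfDegree dH)
    (x₁ x₂ : V) (hx : closedNeighborSet G x₁ = closedNeighborSet G x₂)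
    (y₁ y₂ : W) (hy : H.Adj y₁ y₂)
    (d : ℕ) (hd : d = dG + dH + dG * dH) :
    (strongProduct G H).IsRegularOfDegree d ∧
    Tendsto (fun α : ℝ => ricciCurvature H α y₁ y₂ / (1 - α)) (𝓝[<] 1)
      (𝓝 (llyCurvature H y₁ y₂)) ∧
    (∀ α ∈ Set.Icc (0 : ℝ) (1 / ((d : ℝ) + 1)),
      ricciCurvature (strongProduct G H) α (x₁, y₁) (x₂, y₂) =
        (dH : ℝ) * (llyCurvature H y₁ y₂ - ricciCurvature H 0 y₁ y₂) * α +
          (dH : ℝ) / (d : ℝ) *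
            ((dG : ℝ) * llyCurvature H y₁ y₂ + ricciCurvature H 0 y₁ y₂) * (1 - α)) ∧
    (∀ α ∈ Set.Icc (1 / ((d : ℝ) + 1)) (1 : ℝ),
      ricciCurvature (strongProduct G H) α (x₁, y₁) (x₂, y₂) =
        (dH : ℝ) * ((dG : ℝ) + 1) / (d : ℝ) * llyCurvature H y₁ y₂ * (1 - α)) := by
  have hreg : (strongProduct G H).IsRegularOfDegree d := fun p => by
    rw [degree_strongProduct, hG.degree_eq, hH.degree_eq, hd]
  have hdy : H.degree y₁ = H.degree y₂ := by rw [hH.degree_eq, hH.degree_eq]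
  have hadj : (strongProduct G H).Adj (x₁, y₁) (x₂, y₂) :=
    strongProduct_adj_of_closedNeighborSet_eq hx hy
  have hdp : (strongProduct G H).degree (x₁, y₁) = (strongProduct G H).degree (x₂, y₂) := by
    rw [hreg.degree_eq, hreg.degree_eq]
  have hlly := llyCurvature_eq hdy hy
  have hH0 : (0 : ℝ) < dH := by
    rw [← hH.degree_eq y₁]
    exact_mod_cast (H.degree_pos_iff_exists_adj y₁).2 ⟨y₂, hy⟩
  -- At α = 0 this expresses κ_0 through the cost in H at idleness 0; with `hlly`, both costs in H
  -- become curvatures.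
  have hκ := ricciCurvature_of_le hdy hy le_rfl (by positivity)
  have h0 := transportCost_strongProduct_zero hx hdy hy
  have h1 := transportCost_strongProduct_one hx hdy hy
  rw [hH.degree_eq] at hlly hκ
  rw [hG.degree_eq] at h0 h1
  have hd' : (d : ℝ) = dG + dH + dG * dH := by exact_mod_cast hd
  have hd0 : (0 : ℝ) < dG + dH + dG * dH := by positivity
  refine ⟨hreg, ?_, fun α hα => ?_, fun α hα => ?_⟩
  · rw [llyCurvature_eq hdy hy]
    exact tendsto_ricciCurvature_div hdy hy
  · rw [ricciCurvature_of_le hdp hadj hα.1 (by rw [hreg.degree_eq]; exact hα.2), hreg.degree_eq,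
      h0, h1, hlly, hκ, hd']
    field_simp
    ring
  · rw [ricciCurvature_of_ge hdp hadj (by rw [hreg.degree_eq]; exact hα.1) hα.2, hreg.degree_eq,
      h1, hlly, hd']
    field_simp
    ring
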